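/- Let $d \ge 0$ and let $\mathcal P \subset \mathbb R^d$ be a $d$-dimensional lattice polytope (the convex hull of a nonempty finite subset of $\mathbb Z^d$) such that - $\mathcal P$ is reflexive: the origin is the unique lattice point in the interior of $\mathcal P$, and the dual polytope $\mathcal P^\vee = \{ y \in \mathbb R^d : \langle x, y\rangle \le 1 \text{ for all } x \in \mathcal P\}$ is also a lattice polytope; - $\mathcal P$ is simplicial: every facet of $\mathcal P$ is a simplex; - $\mathcal P$ is pseudo-symmetric: there is a facet $\mathcal F$ of $\mathcal P$ such that $-\mathcal F$ is also a facet of $\mathcal P$. (A facet is a face of dimension $d-1$, where $\dim \emptyset = -1$.) Let $h^*(\mathcal P, x)$ be the $h^*$-polynomial of $\mathcal P$, that is, the polynomial with integer coefficients defined by $$1 + \sum_{k \ge 1} |k\mathcal P \cap \mathbb Z^d|\, x^k = \frac{h^*(\mathcal P, x)}{(1-x)^{d+1}} .$$ Then $h^*(\mathcal P, x)$ is $\gamma$-positive: writing $n$ for its degree, it is palindromic, i.e. $h^*(\mathcal P, x) = x^n h^*(\mathcal P, x^{-1})$, and there are real numbers $\gamma_0, \dots, \gamma_{\lfloor n/2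 \rfloor} \ge 0$ with $$h^*(\mathcal P, x) = \sum_{i=0}^{\lfloor n/2 \rfloor} \gamma_i\, x^i (1+x)^{n-2i} .$$ -/

import Mathlib

open scoped Pointwise Polynomial PowerSeries

namespace LatticePolytope

/-- The embedding of the lattice `ℤ^d` into `ℝ^d`. -/
def latticePoint {d : ℕ} (z : Fin d → ℤ) : Fin d → ℝ := fun i => (z i : ℝ)

/-- A lattice polytope in `ℝ^d`: the convex hull of a nonempty finite set of points of `ℤ^d`. -/
def IsLatticePolytope {d : ℕ} (P : Set (Fin d → ℝ)) : Prop :=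
  ∃ S : Finset (Fin d → ℤ), S.Nonempty ∧ P = convexHull ℝ (latticePoint '' (S : Set (Fin d → ℤ)))

open Classical in
/-- The dimension of a convex set: the dimension of its affine span, with `dim ∅ = -1`. -/
noncomputable def dim {d : ℕ} (A : Set (Fin d → ℝ)) : ℤ :=
  if A = ∅ then -1 else (Module.finrank ℝ (vectorSpan ℝ A) : ℤ)

/-- The dual polytope `{y | ⟨x, y⟩ ≤ 1 for all x ∈ P}`. -/
def dualPolytope {d : ℕ} (P : Set (Fin d → ℝ)) : Set (Fin d → ℝ) :=
  {y | ∀ x ∈ P, x ⬝ᵥ y ≤ 1}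

/-- A reflexive polytope: a full-dimensional lattice polytope whose only interior lattice point is
the origin and whose dual is again a lattice polytope. -/
structure IsReflexive {d : ℕ} (P : Set (Fin d → ℝ)) : Prop where
  isLatticePolytope : IsLatticePolytope P
  dim_eq : dim P = d
  interior_lattice : ∀ z : Fin d → ℤ, latticePoint z ∈ interior P ↔ z = 0
  dual : IsLatticePolytope (dualPolytope P)

/-- A facet: a face (cut out by a supporting hyperplane) of codimension one in `P`. -/
def IsFacet {d : ℕ} (P F : Set (Fin d → ℝ)) : Prop :=
  IsExposed ℝ P F ∧ dim F = dim P - 1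

/-- `F` is a simplex: the convex hull of finitely many affinely independent points. -/
def IsSimplex {d : ℕ} (F : Set (Fin d → ℝ)) : Prop :=
  ∃ S : Finset (Fin d → ℝ),
    AffineIndependent ℝ (fun v : S => (v : Fin d → ℝ)) ∧
      F = convexHull ℝ (S : Set (Fin d → ℝ))

/-- A polytope is simplicial if all its facets are simplices. -/
def IsSimplicial {d : ℕ} (P : Set (Fin d → ℝ)) : Prop :=
  ∀ F, IsFacet P F → IsSimplex F

/-- `P` is pseudo-symmetric if `F` and `-F` are both facets of `P`, for some `F`. -/
def IsPseudoSymmetric {d : ℕ} (P : Set (Fin d → ℝ)) : Prop :=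
  ∃ F, IsFacet P F ∧ IsFacet P (-F)

/-- The lattice point enumerator `L_P(m) = |mP ∩ ℤ^d|`. -/
noncomputable def latticeCount {d : ℕ} (P : Set (Fin d → ℝ)) (m : ℕ) : ℕ :=
  {z : Fin d → ℤ | latticePoint z ∈ (m : ℝ) • P}.ncard

/-- The Ehrhart series `1 + ∑_{k ≥ 1} L_P(k) x^k`. -/
noncomputable def ehrhartSeries {d : ℕ} (P : Set (Fin d → ℝ)) : ℤ⟦X⟧ :=
  PowerSeries.mk fun k => if k = 0 then 1 else (latticeCount P k : ℤ)

/-- `h` is the `h^*`-polynomial of the full-dimensional lattice polytope `P ⊆ ℝ^d`: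
`Ehr_P(x) = h(x) / (1 - x)^(d+1)` as formal power series. Such an `h` is unique. -/
def IsHStarPolynomial {d : ℕ} (P : Set (Fin d → ℝ)) (h : ℤ[X]) : Prop :=
  ehrhartSeries P * (1 - PowerSeries.X) ^ (d + 1) = (h : ℤ⟦X⟧)

/-- A nonzero real polynomial `f` of degree `n` is `γ`-positive if it is palindromic,
`f(x) = x^n f(1/x)`, and `f = ∑_{0 ≤ i ≤ n/2} γ_i x^i (1+x)^(n-2i)` with all `γ_i ≥ 0`. -/
def IsGammaPositive (f : ℝ[X]) : Prop :=
  f ≠ 0 ∧ f.reverse = f ∧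
    ∃ γ : ℕ → ℝ, (∀ i, 0 ≤ γ i) ∧
      f = ∑ i ∈ Finset.range (f.natDegree / 2 + 1),
        Polynomial.C (γ i) * Polynomial.X ^ i * (1 + Polynomial.X) ^ (f.natDegree - 2 * i)

end LatticePolytope

namespace LatticePolytope

set_option linter.unusedSectionVars false

/-! ### Generating functions of weighted sets -/

/-! The vertices of `F` form a basis of the space, and in its coordinates the functional equal to
`1` on `F` is the coordinate sum. Since `-F` is also a facet and the dual is integral, each vertex
has coordinate sum `1`, `0` or `-1`. The outer layers contain exactly the vectors `± eᵢ`.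

Pivoting from `F` to the facet across the ridge opposite `eᵢ` subtracts `a` times the `i`-th
coordinate from this functional, with `a` equal to `1` or `2`. Integrality of facet functionals then
puts all coordinates of lattice points in `½ℤ`. Simpliciality forces the vertices of the middle
layer to have entries in `{0, 1, -1}`, and two of them with overlapping supports to be equal or
opposite (`FacetCoordinates.exists_adjacent`, `of_coord_neg`, `eq_neg_of_overlap`). Hence the
polytope is a free sum of segments `[-eᵢ, eᵢ]` and blocks of even dimension, each block being a
cross-polytope with one extra vertex `v` or two extra vertices `± v`.

The lattice may be larger than `ℤ^ι`, but it is a union of cosets of `ℤ^ι` by half indicator vectors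
of sets `C`; each `C` is of even size and avoids the blocks. On one coset the gauge of the polytope
is a sum over segments and blocks, so its generating function is a product. A segment contributes `1
+ X` or, in `C`, `2 X^(1/2)`, over `1 - X`. In a block of dimension `2k` the gauge is the least `ℓ¹`
distance from `2k + 1` integers (the coordinates up to sign, and `0`) to a constant, restricted to
one sign in the one-sided case. Normalizing the median to zero turns this into counting integer
vectors (`hasGF_medianZero`, `hasGF_oneSided`).

Every coset thus contributes a `γ`-nonnegative polynomial with the same center `d / 2`, and a sum of
such polynomials is again one (`exists_gammaCone_of_blocks`). The constant term `1` makes the degree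
exactly `d`. -/

/-- `F` is the generating function of the set `s` weighted by `w`. -/
def HasGF {α : Type*} (s : Set α) (w : α → ℕ) (F : ℝ⟦X⟧) : Prop :=
  ∀ n, {a ∈ s | w a = n}.Finite ∧ PowerSeries.coeff n F = ({a ∈ s | w a = n}.ncard : ℝ)

namespace HasGF

variable {α β : Type*}

theorem unique {s : Set α} {w : α → ℕ} {F G : ℝ⟦X⟧} (h : HasGF s w F) (h' : HasGF s w G) :
    F = G := by
  ext n
  rw [(h n).2, (h' n).2]

theorem image {s : Set α} {t : Set β} {w : α → ℕ} {w' : β → ℕ} {F : ℝ⟦X⟧} (h : HasGF s w F)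
    {f : α → β} (hf : Set.BijOn f s t) (hw : ∀ a ∈ s, w' (f a) = w a) : HasGF t w' F := by
  intro n
  have : {b ∈ t | w' b = n} = f '' {a ∈ s | w a = n} := by
    ext b
    constructor
    · rintro ⟨hb, hn⟩
      obtain ⟨a, ha, rfl⟩ := hf.surjOn hb
      exact ⟨a, ⟨ha, by rw [← hw a ha, hn]⟩, rfl⟩
    · rintro ⟨a, ⟨ha, hn⟩, rfl⟩
      exact ⟨hf.mapsTo ha, by rw [hw a ha, hn]⟩
  rw [this, (hf.injOn.mono fun a ha => ha.1).ncard_image]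
  exact ⟨(h n).1.image f, (h n).2⟩

theorem subset_finite {s t : Set α} {w : α → ℕ} {F : ℝ⟦X⟧} (h : HasGF t w F) (hst : s ⊆ t) (n : ℕ) :
    {a ∈ s | w a = n}.Finite :=
  (h n).1.subset fun _ ha => ⟨hst ha.1, ha.2⟩

/-- Finiteness is inherited, so an unknown series can be named first and then solved for from a
linear identity. -/
theorem exists_of_subset {s t : Set α} {w : α → ℕ} {F : ℝ⟦X⟧} (h : HasGF t w F) (hst : s ⊆ t) :
    ∃ G, HasGF s w G :=
  ⟨PowerSeries.mk fun n => ({a ∈ s | w a = n}.ncard : ℝ),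
    fun n => ⟨h.subset_finite hst n, by simp⟩⟩

theorem union_inter {s t : Set α} {w : α → ℕ} {F G H K : ℝ⟦X⟧} (hs : HasGF s w F)
    (ht : HasGF t w G) (hu : HasGF (s ∪ t) w H) (hi : HasGF (s ∩ t) w K) : F + G = H + K := by
  ext n
  rw [map_add, map_add, (hs n).2, (ht n).2, (hu n).2, (hi n).2]
  have h1 : {a ∈ s ∪ t | w a = n} = {a ∈ s | w a = n} ∪ {a ∈ t | w a = n} := by
    ext a; simp only [Set.mem_union, Set.mem_ofPred_eq]; tauto
  have h2 : {a ∈ s ∩ t | w a = n} = {a ∈ s | w a = n} ∩ {a ∈ t | w a = n} := by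
    ext a; simp only [Set.mem_inter_iff, Set.mem_ofPred_eq]; tauto
  rw [h1, h2]
  exact_mod_cast (Set.ncard_union_add_ncard_inter _ _ (hs n).1 (ht n).1).symm

theorem empty (w : α → ℕ) : HasGF ∅ w 0 := fun n => by simp

theorem union {s t : Set α} {w : α → ℕ} {F G : ℝ⟦X⟧} (hs : HasGF s w F) (ht : HasGF t w G)
    (hd : Disjoint s t) : HasGF (s ∪ t) w (F + G) := by
  intro n
  have h1 : {a ∈ s ∪ t | w a = n} = {a ∈ s | w a = n} ∪ {a ∈ t | w a = n} := by
    ext a; simp only [Set.mem_union, Set.mem_ofPred_eq]; tauto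
  rw [h1, map_add, (hs n).2, (ht n).2, Set.ncard_union_eq _ (hs n).1 (ht n).1]
  · exact ⟨(hs n).1.union (ht n).1, by push_cast; rfl⟩
  · exact hd.mono (fun _ h => h.1) fun _ h => h.1

theorem biUnion {κ : Type*} (T : Finset κ) (s : κ → Set α) {w : α → ℕ} (F : κ → ℝ⟦X⟧)
    (h : ∀ k ∈ T, HasGF (s k) w (F k)) (hd : (T : Set κ).PairwiseDisjoint s) :
    HasGF (⋃ k ∈ T, s k) w (∑ k ∈ T, F k) := by
  classical
  induction T using Finset.induction_on with
  | empty => simpa using HasGF.empty w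
  | insert k T hk ih =>
    rw [Finset.sum_insert hk, Finset.set_biUnion_insert]
    refine (h k (Finset.mem_insert_self k T)).union
      (ih (fun j hj => h j (Finset.mem_insert_of_mem hj))
        (hd.subset (by simp))) ?_
    rw [Set.disjoint_iUnion₂_right]
    intro j hj
    exact hd (by simp) (by simp [hj]) (by rintro rfl; exact hk hj)

theorem add_const {s : Set α} {w : α → ℕ} {F : ℝ⟦X⟧} (h : HasGF s w F) (k : ℕ) :
    HasGF s (fun a => w a + k) (PowerSeries.X ^ k * F) := by
  intro n
  rw [PowerSeries.coeff_X_pow_mul']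
  split_ifs with hk
  · have : {a ∈ s | w a + k = n} = {a ∈ s | w a = n - k} := by
      ext a; simp only [Set.mem_ofPred_eq]; constructor <;> rintro ⟨h1, h2⟩ <;>
        exact ⟨h1, by omega⟩
    rw [this]
    exact h (n - k)
  · have : {a ∈ s | w a + k = n} = ∅ := by
      ext a; simp only [Set.mem_ofPred_eq, Set.mem_empty_iff_false, iff_false]; rintro ⟨_, h2⟩; omega
    rw [this]
    simp

theorem pi {ι : Type*} [Fintype ι] {γ : ι → Type*} (s : ∀ i, Set (γ i)) (w : ∀ i, γ i → ℕ)
    (F : ι → ℝ⟦X⟧) (h : ∀ i, HasGF (s i) (w i) (F i)) :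
    HasGF (Set.univ.pi s) (fun a => ∑ i, w i (a i)) (∏ i, F i) := by
  classical
  intro n
  have hfin (i : ι) (k : ℕ) : {a ∈ s i | w i a = k}.Finite := (h i k).1
  have key : {a ∈ Set.univ.pi s | ∑ i, w i (a i) = n} =
      ((Finset.finsuppAntidiag Finset.univ n).biUnion fun l =>
        Fintype.piFinset fun i => (hfin i (l i)).toFinset : Finset (∀ i, γ i)) := by
    ext a
    simp only [Set.mem_pi, Set.mem_univ, forall_true_left, Set.mem_ofPred_eq, Finset.coe_biUnion,
      Finset.mem_coe, Finset.mem_finsuppAntidiag, Set.mem_iUnion, Fintype.mem_piFinset,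
      Set.Finite.mem_toFinset, exists_prop]
    constructor
    · rintro ⟨h1, h2⟩
      exact ⟨Finsupp.equivFunOnFinite.symm fun i => w i (a i), ⟨by simpa using h2, by simp⟩,
        fun i => ⟨h1 i, by simp⟩⟩
    · rintro ⟨l, ⟨h1, -⟩, h2⟩
      exact ⟨fun i => (h2 i).1, by rw [← h1]; exact Finset.sum_congr rfl fun i _ => (h2 i).2⟩
  rw [key, Set.ncard_coe_finset, Finset.card_biUnion]
  · refine ⟨Finset.finite_toSet _, ?_⟩
    rw [PowerSeries.coeff_prod]
    push_cast
    refine Finset.sum_congr rfl fun l _ => ?_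
    rw [Fintype.card_piFinset]
    push_cast
    refine Finset.prod_congr rfl fun i _ => ?_
    rw [(h i (l i)).2, Set.ncard_eq_toFinset_card _ (hfin i (l i))]
  · intro l _ l' _ hll
    rw [Function.onFun, Finset.disjoint_left]
    intro a ha ha'
    apply hll
    ext i
    simp only [Fintype.mem_piFinset, Set.Finite.mem_toFinset] at ha ha'
    rw [← (ha i).2, ← (ha' i).2]

theorem prod {s : Set α} {t : Set β} {w : α → ℕ} {v : β → ℕ} {F G : ℝ⟦X⟧} (hs : HasGF s w F)
    (ht : HasGF t v G) : HasGF (s ×ˢ t) (fun p => w p.1 + v p.2) (F * G) := by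
  classical
  intro n
  have hfs (k : ℕ) : {a ∈ s | w a = k}.Finite := (hs k).1
  have hft (k : ℕ) : {a ∈ t | v a = k}.Finite := (ht k).1
  have key : {a ∈ s ×ˢ t | w a.1 + v a.2 = n} =
      ((Finset.HasAntidiagonal.antidiagonal n).biUnion fun l =>
        (hfs l.1).toFinset ×ˢ (hft l.2).toFinset : Finset (α × β)) := by
    ext a
    simp only [Set.mem_prod, Set.mem_ofPred_eq, Finset.coe_biUnion,
      Finset.mem_coe, Finset.HasAntidiagonal.mem_antidiagonal, Set.mem_iUnion, Finset.mem_product,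
      Set.Finite.mem_toFinset, exists_prop]
    constructor
    · rintro ⟨h1, h2⟩
      exact ⟨(w a.1, v a.2), h2, ⟨h1.1, rfl⟩, h1.2, rfl⟩
    · rintro ⟨l, h1, h2, h3⟩
      exact ⟨⟨h2.1, h3.1⟩, by rw [h2.2, h3.2, h1]⟩
  rw [key, Set.ncard_coe_finset, Finset.card_biUnion]
  · refine ⟨Finset.finite_toSet _, ?_⟩
    rw [PowerSeries.coeff_mul]
    push_cast
    refine Finset.sum_congr rfl fun l _ => ?_
    rw [Finset.card_product, (hs l.1).2, (ht l.2).2, Set.ncard_eq_toFinset_card _ (hfs l.1),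
      Set.ncard_eq_toFinset_card _ (hft l.2)]
    push_cast
    rfl
  · intro l _ l' _ hll
    rw [Function.onFun, Finset.disjoint_left]
    intro a ha ha'
    apply hll
    simp only [Finset.mem_product, Set.Finite.mem_toFinset] at ha ha'
    ext
    · rw [← ha.1.2, ← ha'.1.2]
    · rw [← ha.2.2, ← ha'.2.2]

end HasGF

/-- The geometric series `1 / (1 - X)`. -/
noncomputable def geom : ℝ⟦X⟧ := (1 - PowerSeries.X)⁻¹

theorem geom_mul : geom * (1 - PowerSeries.X) = 1 :=
  PowerSeries.inv_mul_cancel _ (by simp)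

theorem geom_pow_mul (n : ℕ) : geom ^ n * (1 - PowerSeries.X) ^ n = 1 := by
  rw [← mul_pow, geom_mul, one_pow]

theorem geom_eq : geom = PowerSeries.mk fun _ => (1 : ℝ) := by
  have h : (PowerSeries.mk fun _ => (1 : ℝ)) * (1 - PowerSeries.X) = 1 :=
    PowerSeries.mk_one_mul_one_sub_eq_one ℝ
  calc geom = geom * ((PowerSeries.mk fun _ => (1 : ℝ)) * (1 - PowerSeries.X)) := by rw [h, mul_one]
    _ = (geom * (1 - PowerSeries.X)) * PowerSeries.mk fun _ => (1 : ℝ) := by ring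
    _ = _ := by rw [geom_mul, one_mul]

theorem hasGF_nat : HasGF (Set.univ : Set ℕ) id geom := fun n => by
  simp [geom_eq]

theorem hasGF_pos : HasGF {y : ℤ | 0 < y} Int.natAbs (PowerSeries.X * geom) := by
  have h := hasGF_nat.add_const 1
  rw [pow_one] at h
  refine h.image (f := fun n : ℕ => (n : ℤ) + 1) ⟨fun n _ => ?_, fun a _ b _ hab => ?_,
    fun y hy => ⟨y.toNat - 1, trivial, ?_⟩⟩ fun n _ => ?_
  · simp only [Set.mem_ofPred_eq]; omega
  · simp only at hab; omega
  · simp only [Set.mem_ofPred_eq] at hy ⊢; omega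
  · simp only [id]; omega

theorem hasGF_nonpos : HasGF {y : ℤ | y ≤ 0} Int.natAbs geom := by
  refine hasGF_nat.image (f := fun n : ℕ => -(n : ℤ)) ⟨fun n _ => ?_, fun a _ b _ hab => ?_,
    fun y hy => ⟨y.natAbs, trivial, ?_⟩⟩ fun n _ => ?_
  · simp
  · simp only at hab; omega
  · simp only [Set.mem_ofPred_eq] at hy ⊢; omega
  · simp only [id]; omega

theorem hasGF_int : HasGF (Set.univ : Set ℤ) Int.natAbs ((1 + PowerSeries.X) * geom) := by
  have h := hasGF_nonpos.union hasGF_pos (by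
    rw [Set.disjoint_left]; intro y; simp only [Set.mem_ofPred_eq]; omega)
  have h1 : ({y : ℤ | y ≤ 0} ∪ {y : ℤ | 0 < y}) = Set.univ := by
    ext y; simp only [Set.mem_union, Set.mem_ofPred_eq, Set.mem_univ, iff_true]; omega
  rw [h1] at h
  convert h using 1
  ring

/-- The weight `|y + 1/2| - 1/2`. -/
def halfAbs (y : ℤ) : ℕ := if 0 ≤ y then y.toNat else (-y - 1).toNat

theorem hasGF_halfAbs : HasGF (Set.univ : Set ℤ) halfAbs (2 * geom) := by
  have h1 : HasGF {y : ℤ | 0 ≤ y} halfAbs geom := by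
    refine hasGF_nat.image (f := fun n : ℕ => (n : ℤ)) ⟨fun n _ => ?_, fun a _ b _ hab => ?_,
      fun y hy => ⟨y.natAbs, trivial, ?_⟩⟩ fun n _ => ?_
    · simp only [Set.mem_ofPred_eq]; omega
    · simp only at hab; omega
    · simp only [Set.mem_ofPred_eq] at hy ⊢; omega
    · simp only [id, halfAbs]; split_ifs <;> omega
  have h2 : HasGF {y : ℤ | y < 0} halfAbs geom := by
    refine hasGF_nat.image (f := fun n : ℕ => -(n : ℤ) - 1) ⟨fun n _ => ?_, fun a _ b _ hab => ?_,
      fun y hy => ⟨y.natAbs - 1, trivial, ?_⟩⟩ fun n _ => ?_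
    · simp only [Set.mem_ofPred_eq]; omega
    · simp only at hab; omega
    · simp only [Set.mem_ofPred_eq] at hy ⊢; omega
    · simp only [id, halfAbs]; split_ifs <;> omega
  have h := h1.union h2 (by
    rw [Set.disjoint_left]; intro y; simp only [Set.mem_ofPred_eq]; omega)
  have h3 : ({y : ℤ | 0 ≤ y} ∪ {y : ℤ | y < 0}) = Set.univ := by
    ext y; simp only [Set.mem_union, Set.mem_ofPred_eq, Set.mem_univ, iff_true]; omega
  rw [h3] at h
  convert h using 1
  ring

/-! ### Cones of `γ`-positive polynomials with a fixed center of symmetry -/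

/-- `f` is a nonnegative combination of the polynomials `X^i (1+X)^(n-2i)` with `2i ≤ n`. -/
def GammaCone (n : ℕ) (f : ℝ[X]) : Prop :=
  ∃ γ : ℕ → ℝ, (∀ i, 0 ≤ γ i) ∧
    f = ∑ i ∈ Finset.range (n / 2 + 1),
      Polynomial.C (γ i) * Polynomial.X ^ i * (1 + Polynomial.X) ^ (n - 2 * i)

namespace GammaCone

variable {m n : ℕ} {f g : ℝ[X]}

theorem zero (n : ℕ) : GammaCone n 0 := ⟨fun _ => 0, fun _ => le_rfl, by simp⟩

theorem add (hf : GammaCone n f) (hg : GammaCone n g) : GammaCone n (f + g) := by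
  obtain ⟨γ, h0, rfl⟩ := hf
  obtain ⟨δ, h1, rfl⟩ := hg
  refine ⟨fun i => γ i + δ i, fun i => add_nonneg (h0 i) (h1 i), ?_⟩
  rw [← Finset.sum_add_distrib]
  refine Finset.sum_congr rfl fun i _ => ?_
  rw [Polynomial.C_add]
  ring

theorem sum {κ : Type*} {T : Finset κ} {f : κ → ℝ[X]} (h : ∀ k ∈ T, GammaCone n (f k)) :
    GammaCone n (∑ k ∈ T, f k) := by
  classical
  induction T using Finset.induction_on with
  | empty => simpa using GammaCone.zero n
  | insert k T hk ih =>
    rw [Finset.sum_insert hk]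
    exact (h k (Finset.mem_insert_self k T)).add
      (ih fun j hj => h j (Finset.mem_insert_of_mem hj))

theorem basis {i : ℕ} {c : ℝ} (hc : 0 ≤ c) (hi : 2 * i ≤ n) :
    GammaCone n (Polynomial.C c * Polynomial.X ^ i * (1 + Polynomial.X) ^ (n - 2 * i)) := by
  refine ⟨fun j => if j = i then c else 0, fun j => ?_, ?_⟩
  · dsimp only; split_ifs <;> simp [hc]
  · rw [Finset.sum_eq_single i]
    · simp
    · intro j _ hj; simp [hj]
    · intro h; exact absurd (Finset.mem_range.2 (by omega)) h

/-- Products of basis elements are basis elements, and the centers of symmetry add. -/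
theorem mul (hf : GammaCone m f) (hg : GammaCone n g) : GammaCone (m + n) (f * g) := by
  obtain ⟨γ, h0, rfl⟩ := hf
  obtain ⟨δ, h1, rfl⟩ := hg
  rw [Finset.sum_mul_sum]
  refine GammaCone.sum fun i hi => GammaCone.sum fun j hj => ?_
  rw [Finset.mem_range] at hi hj
  convert GammaCone.basis (n := m + n) (i := i + j) (mul_nonneg (h0 i) (h1 j)) (by omega) using 1
  rw [show m + n - 2 * (i + j) = (m - 2 * i) + (n - 2 * j) by omega, Polynomial.C_mul]
  ring

theorem one : GammaCone 0 1 := by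
  simpa using GammaCone.basis (n := 0) (i := 0) zero_le_one le_rfl

theorem smul {c : ℝ} (hc : 0 ≤ c) (hf : GammaCone n f) : GammaCone n (Polynomial.C c * f) := by
  have := GammaCone.mul (GammaCone.basis (n := 0) (i := 0) hc le_rfl) hf
  simpa using this

theorem prod {κ : Type*} {T : Finset κ} {f : κ → ℝ[X]} {n : κ → ℕ}
    (h : ∀ k ∈ T, GammaCone (n k) (f k)) : GammaCone (∑ k ∈ T, n k) (∏ k ∈ T, f k) := by
  classical
  induction T using Finset.induction_on with
  | empty => simpa using GammaCone.one
  | insert k T hk ih =>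
    rw [Finset.sum_insert hk, Finset.prod_insert hk]
    exact (h k (Finset.mem_insert_self k T)).mul
      (ih fun j hj => h j (Finset.mem_insert_of_mem hj))

theorem one_add_pow (n : ℕ) : GammaCone n ((1 + Polynomial.X) ^ n) := by
  simpa using GammaCone.basis (n := n) (i := 0) zero_le_one (Nat.zero_le _)

theorem natDegree_le (hf : GammaCone n f) : f.natDegree ≤ n := by
  obtain ⟨γ, -, rfl⟩ := hf
  refine Polynomial.natDegree_sum_le_of_forall_le _ _ fun i hi => ?_
  rw [Finset.mem_range] at hi
  compute_degree
  omega

theorem reflect_eq (hf : GammaCone n f) : f.reflect n = f := by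
  obtain ⟨γ, -, rfl⟩ := hf
  let φ : ℝ[X] →+ ℝ[X] :=
    { toFun := Polynomial.reflect n
      map_zero' := Polynomial.reflect_zero
      map_add' := fun a b => Polynomial.reflect_add a b n }
  have one_add (k : ℕ) : ((1 + Polynomial.X : ℝ[X]) ^ k).reflect k = (1 + Polynomial.X) ^ k := by
    ext j
    rw [Polynomial.coeff_reflect]
    rw [Polynomial.coeff_one_add_X_pow, Polynomial.coeff_one_add_X_pow]
    rcases le_or_gt j k with h | h
    · rw [Polynomial.revAt_le h, Nat.choose_symm h]
    · rw [Polynomial.revAt_eq_self_of_lt h]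
  have hφ (f : ℝ[X]) : φ f = f.reflect n := rfl
  rw [← hφ, map_sum]
  refine Finset.sum_congr rfl fun i hi => ?_
  rw [Finset.mem_range] at hi
  rw [hφ]
  have h : n = 2 * i + (n - 2 * i) := by omega
  conv_lhs => rw [h]
  rw [show 2 * i + (n - 2 * i) - 2 * i = n - 2 * i by omega]
  rw [Polynomial.reflect_mul, one_add, Polynomial.reflect_C_mul_X_pow,
    Polynomial.revAt_le (by omega)]
  · congr 3; omega
  · compute_degree; omega
  · compute_degree

/-- Reflection moves the nonzero constant term to degree `n`, so the center fixed by the cone is the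
one given by the actual degree. -/
theorem isGammaPositive (hf : GammaCone n f) (h0 : f.coeff 0 ≠ 0) : IsGammaPositive f := by
  have hn : f.coeff n ≠ 0 := by
    have := Polynomial.coeff_reflect n f n
    rw [hf.reflect_eq, Polynomial.revAt_le le_rfl, Nat.sub_self] at this
    rwa [this]
  have hd : f.natDegree = n :=
    le_antisymm hf.natDegree_le (Polynomial.le_natDegree_of_ne_zero hn)
  refine ⟨by rintro rfl; simp at h0, ?_, ?_⟩
  · rw [Polynomial.reverse, hd, hf.reflect_eq]
  · rw [hd]; exact hf

end GammaCone

/-! ### The polynomials of the del Pezzo blocks -/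

/-- The `h`-polynomial `∑ᵢ C(2i,i) xⁱ (1+x)^(2k-2i)` of the del Pezzo polytope of dimension `2k`. -/
noncomputable def blockPoly : ℕ → ℝ[X]
  | 0 => 1
  | k + 1 => (1 + Polynomial.X) ^ 2 * blockPoly k +
      Polynomial.C ((2 * k + 2).choose (k + 1) : ℝ) * Polynomial.X ^ (k + 1)

theorem gammaCone_blockPoly (k : ℕ) : GammaCone (2 * k) (blockPoly k) := by
  induction k with
  | zero => exact GammaCone.one
  | succ k ih =>
    rw [blockPoly]
    refine GammaCone.add ?_ ?_
    · convert (GammaCone.one_add_pow 2).mul ih using 1; ring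
    · have := GammaCone.basis (n := 2 * (k + 1)) (i := k + 1)
        (c := ((2 * k + 2).choose (k + 1) : ℝ)) (by positivity) le_rfl
      simpa using this

/-- The part of `(1+X)^(2k+1)` of degree greater than `k`. -/
noncomputable def upperHalf (k : ℕ) : ℝ[X] :=
  ∑ a ∈ Finset.range (2 * k + 2), (2 * k + 1).choose a • if k < a then Polynomial.X ^ a else 0

theorem coeff_upperHalf (k a : ℕ) :
    (upperHalf k).coeff a = if k < a then ((2 * k + 1).choose a : ℝ) else 0 := by
  rw [upperHalf, Polynomial.finsetSum_coeff]
  have (b : ℕ) : ((2 * k + 1).choose b • if k < b then (Polynomial.X : ℝ[X]) ^ b else 0).coeff a =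
      if a = b then (if k < a then ((2 * k + 1).choose a : ℝ) else 0) else 0 := by
    rw [Polynomial.coeff_smul]
    by_cases hab : a = b
    · subst hab; rw [if_pos rfl]; split_ifs <;> simp
    · split_ifs <;> simp [Polynomial.coeff_X_pow, hab]
  simp only [this, Finset.sum_ite_eq, Finset.mem_range]
  split_ifs with h1 h2
  · rfl
  · rfl
  · rw [Nat.choose_eq_zero_of_lt (by omega)]; simp
  · rfl

/-- Multiplying by `(1 + X)^2` is Pascal's rule applied twice. The correction accounts for the
cutoff moving from `k` to `k + 1`: the term of degree `k + 1` is dropped, and that of degree `k + 2`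
gains the contribution of the truncated degree `k`. -/
theorem upperHalf_succ (k : ℕ) :
    upperHalf (k + 1) = (1 + Polynomial.X) ^ 2 * upperHalf k -
      (1 - Polynomial.X) * (Polynomial.C ((2 * k + 1).choose k : ℝ) * Polynomial.X ^ (k + 1)) := by
  have e : (1 + Polynomial.X) ^ 2 * upperHalf k -
      (1 - Polynomial.X) * (Polynomial.C ((2 * k + 1).choose k : ℝ) * Polynomial.X ^ (k + 1)) =
      upperHalf k + 2 * (upperHalf k * Polynomial.X) + upperHalf k * Polynomial.X * Polynomial.X
      - Polynomial.C ((2 * k + 1).choose k : ℝ) * Polynomial.X ^ (k + 1)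
      + Polynomial.C ((2 * k + 1).choose k : ℝ) * Polynomial.X ^ (k + 2) := by ring
  rw [e]
  have sym : (2 * k + 1).choose (k + 1) = (2 * k + 1).choose k := Nat.choose_symm_half k
  ext a
  rw [coeff_upperHalf]
  simp only [Polynomial.coeff_add, Polynomial.coeff_sub, Polynomial.coeff_C_mul,
    Polynomial.coeff_X_pow, Polynomial.coeff_ofNat_mul]
  rcases a with _ | _ | b
  · simp [coeff_upperHalf]
  · rw [Polynomial.coeff_mul_X, Polynomial.coeff_mul_X, Polynomial.mul_coeff_zero]
    simp only [coeff_upperHalf]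
    rcases Nat.eq_zero_or_pos k with rfl | hk
    · norm_num
    · simp [hk.ne', show ¬ k < 1 by omega]
  · rw [Polynomial.coeff_mul_X, Polynomial.coeff_mul_X, Polynomial.coeff_mul_X]
    simp only [coeff_upperHalf]
    have pas : (2 * (k + 1) + 1).choose (b + 1 + 1) = (2 * k + 1).choose (b + 2) +
        2 * (2 * k + 1).choose (b + 1) + (2 * k + 1).choose b := by
      rw [show 2 * (k + 1) + 1 = (2 * k + 1) + 1 + 1 by ring, Nat.choose_succ_succ _ (b + 1),
        Nat.choose_succ_succ _ (b + 1), Nat.choose_succ_succ _ b]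
      ring
    rw [pas]
    rcases lt_trichotomy b k with h | rfl | h
    · rcases (by omega : b + 1 = k ∨ b + 1 < k) with rfl | h'
      · simp [sym]
      · simp [show ¬ k < b + 1 + 1 by omega, show ¬ k + 1 < b + 1 + 1 by omega,
          show ¬ k < b + 1 by omega, show ¬ k < b by omega, show ¬ b + 1 = k by omega,
          show ¬ b = k by omega]
    · simp
    · simp [show k < b + 1 + 1 by omega, show k + 1 < b + 1 + 1 by omega,
          show k < b + 1 by omega, h, show ¬ b + 1 = k by omega,
          show ¬ b = k by omega]

/-- This links the `γ`-expansion to a count: the right side keeps the sign patterns on `2k + 1`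
coordinates in which positives are not a majority, and by symmetry removes as many again for the
negatives. -/
theorem one_sub_mul_blockPoly (k : ℕ) :
    (1 - Polynomial.X) * blockPoly k = (1 + Polynomial.X) ^ (2 * k + 1) - 2 * upperHalf k := by
  induction k with
  | zero =>
    have : upperHalf 0 = Polynomial.X := by simp [upperHalf, Finset.sum_range_succ]
    rw [this, blockPoly]
    ring
  | succ k ih =>
    have h2 : ((2 * k + 2).choose (k + 1) : ℝ) = 2 * ((2 * k + 1).choose k : ℝ) := by
      rw [Nat.choose_succ_succ, Nat.choose_symm_half]; push_cast; ring
    rw [upperHalf_succ, blockPoly, h2, Polynomial.C_mul, Polynomial.C_ofNat]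
    linear_combination (1 + Polynomial.X) ^ 2 * ih

/-! ### Generating functions of the blocks -/

section Block

variable {O : Type*} [Fintype O]

theorem hasGF_pi_int (O : Type*) [Fintype O] :
    HasGF (Set.univ : Set (O → ℤ)) (fun y => ∑ o, (y o).natAbs)
      ((1 + PowerSeries.X) ^ Fintype.card O * geom ^ Fintype.card O) := by
  have := HasGF.pi (fun _ : O => (Set.univ : Set ℤ)) (fun _ => Int.natAbs) _ fun _ => hasGF_int
  simpa [mul_pow] using this

theorem hasGF_pos_eq (A : Finset O) :
    HasGF {y : O → ℤ | Finset.univ.filter (fun o => 0 < y o) = A} (fun y => ∑ o, (y o).natAbs)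
      (PowerSeries.X ^ A.card * geom ^ Fintype.card O) := by
  classical
  have h := HasGF.pi (fun o : O => if o ∈ A then {y : ℤ | 0 < y} else {y : ℤ | y ≤ 0})
    (fun _ => Int.natAbs) (fun o => (if o ∈ A then PowerSeries.X else 1) * geom) fun o => by
      split_ifs
      · exact hasGF_pos
      · simpa using hasGF_nonpos
  convert h using 1
  · ext y
    simp only [Set.mem_ofPred_eq, Finset.ext_iff, Finset.mem_filter, Finset.mem_univ, true_and,
      Set.mem_pi]
    refine forall_congr' fun o => ?_
    split_ifs with ho <;> simp [ho]
  · rw [Finset.prod_mul_distrib]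
    simp

theorem hasGF_card_pos_gt {k : ℕ} (hO : Fintype.card O = 2 * k + 1) :
    HasGF {y : O → ℤ | k < (Finset.univ.filter fun o => 0 < y o).card}
      (fun y => ∑ o, (y o).natAbs) ((upperHalf k : ℝ⟦X⟧) * geom ^ (2 * k + 1)) := by
  classical
  have h := HasGF.biUnion ((Finset.univ : Finset (Finset O)).filter fun A => k < A.card) _ _
    (fun A _ => hasGF_pos_eq A) (by
      intro A _ B _ hAB
      rw [Function.onFun, Set.disjoint_left]
      rintro y rfl h
      exact hAB h)
  convert h using 1
  · ext y
    simp
  · rw [← Finset.sum_mul, hO, Finset.sum_filter, ← Finset.powerset_univ,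
      Finset.sum_powerset_apply_card (fun a => if k < a then (PowerSeries.X : ℝ⟦X⟧) ^ a else 0),
      Finset.card_univ, hO, upperHalf]
    congr 1
    rw [← Polynomial.coeToPowerSeries.ringHom_apply, map_sum]
    refine Finset.sum_congr rfl fun a _ => ?_
    rw [map_nsmul]
    split_ifs <;> simp

theorem hasGF_neg {s : Set (O → ℤ)} {F : ℝ⟦X⟧} (h : HasGF s (fun y => ∑ o, (y o).natAbs) F) :
    HasGF (-s) (fun y => ∑ o, (y o).natAbs) F := by
  refine h.image (f := fun y => -y) ⟨fun y hy => ?_, neg_injective.injOn, fun y hy => ?_⟩ ?_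
  · simpa using hy
  · exact ⟨-y, hy, neg_neg y⟩
  · intro y _; simp

/-- Integer vectors whose median is zero, for an index set of size `2k+1`. -/
def medianZero (O : Type*) [Fintype O] (k : ℕ) : Set (O → ℤ) :=
  {y | (Finset.univ.filter fun o => 0 < y o).card ≤ k ∧
    (Finset.univ.filter fun o => y o < 0).card ≤ k}

/-- The complement consists of the vectors with a positive majority and their negatives, which are
disjoint. Subtracting both series from that of all vectors leaves a numerator divisible by `1 - X`,
which lowers the exponent of `geom` by one. -/
theorem hasGF_medianZero {k : ℕ} (hO : Fintype.card O = 2 * k + 1) :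
    HasGF (medianZero O k) (fun y => ∑ o, (y o).natAbs)
      ((blockPoly k : ℝ⟦X⟧) * geom ^ (2 * k)) := by
  classical
  have hp := hasGF_card_pos_gt hO
  have hn := hasGF_neg hp
  have hu := hp.union hn (by
    rw [Set.disjoint_left]
    intro y hy hy'
    simp only [Set.mem_neg, Set.mem_ofPred_eq, Pi.neg_apply] at hy hy'
    have hd : Disjoint (Finset.univ.filter fun o => 0 < y o)
        (Finset.univ.filter fun o => 0 < -y o) := by
      rw [Finset.disjoint_filter]; intro o _; omega
    have := Finset.card_le_univ ((Finset.univ.filter fun o => 0 < y o) ∪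
      (Finset.univ.filter fun o => 0 < -y o))
    rw [Finset.card_union_of_disjoint hd] at this
    omega)
  have hall := hasGF_pi_int O
  obtain ⟨G, hG⟩ := hall.exists_of_subset (Set.subset_univ (medianZero O k))
  have hcup : ({y : O → ℤ | k < (Finset.univ.filter fun o => 0 < y o).card} ∪
      -{y : O → ℤ | k < (Finset.univ.filter fun o => 0 < y o).card}) = (medianZero O k)ᶜ := by
    ext y
    simp only [Set.mem_union, Set.mem_neg, Set.mem_ofPred_eq, Pi.neg_apply, Set.mem_compl_iff,
      medianZero, not_and_or, not_le, Left.neg_pos_iff]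
  rw [hcup] at hu
  have htot := (hG.union hu disjoint_compl_right)
  rw [Set.union_compl_self] at htot
  have heq := htot.unique hall
  have hk := congrArg (fun f : ℝ[X] => (f : ℝ⟦X⟧)) (one_sub_mul_blockPoly k)
  simp only [Polynomial.coe_mul, Polynomial.coe_sub, Polynomial.coe_pow, Polynomial.coe_add,
    Polynomial.coe_one, Polynomial.coe_X] at hk
  have h2 : ((2 : ℝ[X]) : ℝ⟦X⟧) = 2 := map_ofNat Polynomial.coeToPowerSeries.ringHom 2
  rw [h2] at hk
  rw [hO] at heq
  have : G = (blockPoly k : ℝ⟦X⟧) * geom ^ (2 * k) := by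
    linear_combination heq - geom ^ (2 * k + 1) * hk +
      (blockPoly k : ℝ⟦X⟧) * geom ^ (2 * k) * geom_mul
  rwa [this] at hG

variable {J : Type*} [Fintype J]

/-- The vectors `y` parametrizing lattice points of a one-sided block. -/
def oneSided (J : Type*) [Fintype J] (k : ℕ) : Set (Option J → ℤ) :=
  {y | y none ≤ 0 ∧ (Finset.univ.filter fun o => 0 < y o).card ≤ k ∧
    (y none < 0 → (Finset.univ.filter fun o => y o < 0).card ≤ k)}

theorem hasGF_none_eq_zero (J : Type*) [Fintype J] :
    HasGF {y : Option J → ℤ | y none = 0} (fun y => ∑ o, (y o).natAbs)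
      ((1 + PowerSeries.X) ^ Fintype.card J * geom ^ Fintype.card J) := by
  refine (hasGF_pi_int J).image (f := fun y o => o.elim 0 y)
    ⟨fun y _ => rfl, fun y _ z _ h => ?_, fun y hy => ⟨fun j => y (some j), trivial, ?_⟩⟩ ?_
  · funext j; exact congrFun h (some j)
  · funext o
    cases o with
    | none => exact hy.symm
    | some j => rfl
  · intro y _
    simp [Fintype.sum_option]

/-- Inclusion-exclusion for the set and its negative: they have the same series, and their union and
intersection agree with those of the median-zero vectors and the hyperplane `y none = 0`. Hence
twice the unknown series is the sum of two known ones. -/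
theorem hasGF_oneSided {k : ℕ} (hJ : Fintype.card J = 2 * k) :
    HasGF (oneSided J k) (fun y => ∑ o, (y o).natAbs)
      (((Polynomial.C (1 / 2 : ℝ) * (blockPoly k + (1 + Polynomial.X) ^ (2 * k)) : ℝ[X]) : ℝ⟦X⟧) *
        geom ^ (2 * k)) := by
  classical
  have hO : Fintype.card (Option J) = 2 * k + 1 := by rw [Fintype.card_option, hJ]
  have h2 := hasGF_medianZero hO
  have hZ := hasGF_none_eq_zero J
  rw [hJ] at hZ
  obtain ⟨G, hG⟩ := (hasGF_pi_int (Option J)).exists_of_subset (Set.subset_univ (oneSided J k))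
  have hd (y : Option J → ℤ) : (Finset.univ.filter fun o => 0 < y o).card +
      (Finset.univ.filter fun o => y o < 0).card + (if y none = 0 then 1 else 0) ≤ 2 * k + 1 := by
    have hd : Disjoint (Finset.univ.filter fun o => 0 < y o)
        (Finset.univ.filter fun o => y o < 0) := by
      rw [Finset.disjoint_filter]; intro o _; omega
    rw [← Finset.card_union_of_disjoint hd, ← hO]
    split_ifs with h0
    · refine Finset.card_lt_univ_of_notMem (x := none) ?_
      simp [h0]
    · rw [add_zero]; exact Finset.card_le_univ _
  -- When `y none = 0` only `2k` entries can be nonzero, so positives and negatives cannot both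
  -- exceed `k`.
  have hun : oneSided J k ∪ -oneSided J k = medianZero (Option J) k ∪ {y | y none = 0} := by
    ext y
    have := hd y
    simp only [Set.mem_union, Set.mem_neg, oneSided, medianZero, Set.mem_ofPred_eq, Pi.neg_apply,
      Left.neg_pos_iff, Left.neg_neg_iff]
    split_ifs at this <;> omega
  have hin : oneSided J k ∩ -oneSided J k = medianZero (Option J) k ∩ {y | y none = 0} := by
    ext y
    simp only [Set.mem_inter_iff, Set.mem_neg, oneSided, medianZero, Set.mem_ofPred_eq,
      Pi.neg_apply, Left.neg_pos_iff, Left.neg_neg_iff]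
    omega
  obtain ⟨U, hU⟩ := (hasGF_pi_int (Option J)).exists_of_subset
    (Set.subset_univ (oneSided J k ∪ -oneSided J k))
  obtain ⟨I, hI⟩ := (hasGF_pi_int (Option J)).exists_of_subset
    (Set.subset_univ (oneSided J k ∩ -oneSided J k))
  have e1 := hG.union_inter (hasGF_neg hG) hU hI
  rw [hun] at hU
  rw [hin] at hI
  have e2 := h2.union_inter hZ hU hI
  have hc : (PowerSeries.C (1 / 2 : ℝ) : ℝ⟦X⟧) * 2 = 1 := by
    rw [← map_ofNat (PowerSeries.C (R := ℝ)) 2, ← map_mul]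
    norm_num
  have : G = (((Polynomial.C (1 / 2 : ℝ) * (blockPoly k + (1 + Polynomial.X) ^ (2 * k)) :
      ℝ[X]) : ℝ⟦X⟧) * geom ^ (2 * k)) := by
    simp only [Polynomial.coe_mul, Polynomial.coe_pow, Polynomial.coe_add,
      Polynomial.coe_one, Polynomial.coe_X, Polynomial.coe_C]
    linear_combination PowerSeries.C (1 / 2 : ℝ) * (e1 - e2) - G * hc
  rwa [this] at hG

end Block

theorem gammaCone_oneSided (k : ℕ) : GammaCone (2 * k)
    (Polynomial.C (1 / 2 : ℝ) * (blockPoly k + (1 + Polynomial.X) ^ (2 * k))) :=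
  ((gammaCone_blockPoly k).add (GammaCone.one_add_pow _)).smul (by norm_num)

/-! ### Pseudo-symmetric simplicial reflexive polytopes in the coordinates of a facet -/

section Structure

variable {ι : Type*} [Fintype ι] [DecidableEq ι]

/-- The vertex set `V` and the lattice `L` of a simplicial reflexive polytope, in the coordinates
given by the vertices of a facet `F` such that `-F` is a facet as well. -/
structure FacetCoordinates (V : Set (ι → ℝ)) (L : AddSubgroup (ι → ℝ)) : Prop where
  finite : V.Finite
  subset : ∀ x ∈ V, x ∈ L
  pos : ∀ i, Pi.single i 1 ∈ V
  neg : ∀ i, Pi.single i (-1) ∈ V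
  sum_int : ∀ z ∈ L, ∃ n : ℤ, ∑ i, z i = n
  le_one : ∀ x ∈ V, ∑ i, x i ≤ 1
  neg_one_le : ∀ x ∈ V, -1 ≤ ∑ i, x i
  eq_pos : ∀ x ∈ V, ∑ i, x i = 1 → ∃ i, x = Pi.single i 1
  eq_neg : ∀ x ∈ V, ∑ i, x i = -1 → ∃ i, x = Pi.single i (-1)
  ne_zero : ∀ x ∈ V, x ≠ 0
  facet : ∀ (g : ι → ℝ) (i : ι) (w : ι → ℝ), (∀ j, j ≠ i → g j = 1 ∨ g j = -1) → w ∈ V →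
    w i ≠ 0 → g ⬝ᵥ w = 1 → (∀ x ∈ V, g ⬝ᵥ x ≤ 1) →
    (∀ x ∈ V, g ⬝ᵥ x = 1 → x = w ∨ ∃ j, j ≠ i ∧ x = Pi.single j (g j)) ∧
      ∀ z ∈ L, ∃ n : ℤ, g ⬝ᵥ z = n

namespace FacetCoordinates

variable {V : Set (ι → ℝ)} {L : AddSubgroup (ι → ℝ)}

/-- The roles of `F` and `-F` are interchangeable, so each statement about negative coordinates
yields one about positive coordinates. -/
theorem negate (h : FacetCoordinates V L) : FacetCoordinates (-V) L where
  finite := h.finite.neg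
  subset x hx := by simpa using L.neg_mem (h.subset _ hx)
  pos i := by rw [Set.mem_neg, ← Pi.single_neg]; exact h.neg i
  neg i := by rw [Set.mem_neg, ← Pi.single_neg, neg_neg]; exact h.pos i
  sum_int := h.sum_int
  le_one x hx := by have := h.neg_one_le _ hx; simp at this; linarith
  neg_one_le x hx := by have := h.le_one _ hx; simp at this; linarith
  eq_pos x hx hs := by
    obtain ⟨i, hi⟩ := h.eq_neg _ hx (by simp [hs])
    exact ⟨i, by rw [← neg_neg x, hi, ← Pi.single_neg, neg_neg]⟩
  eq_neg x hx hs := by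
    obtain ⟨i, hi⟩ := h.eq_pos _ hx (by simp [hs])
    exact ⟨i, by rw [← neg_neg x, hi, ← Pi.single_neg]⟩
  ne_zero x hx := fun h0 => h.ne_zero _ hx (by simp [h0])
  facet g i w hg hw hi hgw hle := by
    obtain ⟨h1, h2⟩ := h.facet (-g) i (-w)
      (fun j hj => by rcases hg j hj with h | h <;> simp [h]) hw (by simpa using hi)
      (by simpa using hgw) (fun x hx => by simpa using hle (-x) (by simpa using hx))
    refine ⟨fun x hx hgx => ?_, fun z hz => ?_⟩
    · rcases h1 (-x) hx (by simpa using hgx) with h | ⟨j, hj, h⟩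
      · exact Or.inl (neg_injective h)
      · exact Or.inr ⟨j, hj, by rw [← neg_neg x, h, ← Pi.single_neg]; simp⟩
    · obtain ⟨n, hn⟩ := h2 (-z) (L.neg_mem hz)
      exact ⟨n, by simpa using hn⟩

theorem dotProduct_one_sub_single (i : ι) (a : ℝ) (x : ι → ℝ) :
    (1 - Pi.single i a) ⬝ᵥ x = ∑ j, x j - a * x i := by
  rw [sub_dotProduct, single_dotProduct, one_dotProduct]

/-- Tilt the functional of `F` about the ridge omitting `eᵢ` until it meets another vertex `w`. The
resulting hyperplane carries a facet, so it is integral on `L` and its only vertices besides `w` are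
among the `eⱼ`. -/
theorem exists_adjacent (h : FacetCoordinates V L) (i : ι) :
    ∃ a : ℝ, (a = 1 ∨ a = 2) ∧ (∀ x ∈ V, ∑ j, x j - a * x i ≤ 1) ∧
      (∃ w ∈ V, ∀ x ∈ V, ∑ j, x j - a * x i = 1 → x = w ∨ ∃ j, x = Pi.single j 1) ∧
      ∀ z ∈ L, ∃ n : ℤ, a * z i = n := by
  have hT : ({x ∈ V | x i < 0}).Finite := h.finite.subset fun x hx => hx.1
  have hmem : Pi.single i (-1) ∈ {x ∈ V | x i < 0} := ⟨h.neg i, by simp⟩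
  -- The ratio is the slope at which the tilted hyperplane reaches `x`; the least one keeps it
  -- supporting. At `-eᵢ` it equals `2`, which bounds `a`.
  obtain ⟨w, ⟨hwV, hwi⟩, hmin⟩ := Set.exists_min_image _
    (fun x : ι → ℝ => (1 - ∑ j, x j) / (-x i)) hT ⟨_, hmem⟩
  set a := (1 - ∑ j, w j) / (-w i) with ha
  have haw : a * w i = ∑ j, w j - 1 := by
    have := hwi.ne
    rw [ha]; field_simp; ring
  have ha2 : a ≤ 2 := by
    have := hmin _ hmem
    simp only [Finset.sum_pi_single', Finset.mem_univ, if_true, Pi.single_eq_same] at this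
    linarith
  have ha0 : 0 < a := by
    refine div_pos ?_ (by linarith)
    rcases (h.le_one w hwV).lt_or_eq with h1 | h1
    · linarith
    · obtain ⟨j, hj⟩ := h.eq_pos w hwV h1
      exfalso
      rw [hj, Pi.single_apply] at hwi
      split_ifs at hwi <;> linarith
  have hle (x) (hx : x ∈ V) : ∑ j, x j - a * x i ≤ 1 := by
    rcases lt_or_ge (x i) 0 with hxi | hxi
    · have := hmin x ⟨hx, hxi⟩
      rw [le_div_iff₀ (by linarith)] at this
      linarith
    · have := h.le_one x hx
      have := mul_nonneg ha0.le hxi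
      linarith
  obtain ⟨h1, h2⟩ := h.facet (1 - Pi.single i a) i w
    (fun j hj => Or.inl (by simp [hj])) hwV hwi.ne
    (by rw [dotProduct_one_sub_single]; linarith)
    (fun x hx => by rw [dotProduct_one_sub_single]; exact hle x hx)
  have hint (z) (hz : z ∈ L) : ∃ n : ℤ, a * z i = n := by
    obtain ⟨n, hn⟩ := h2 z hz
    obtain ⟨m, hm⟩ := h.sum_int z hz
    rw [dotProduct_one_sub_single] at hn
    exact ⟨m - n, by push_cast; linarith⟩
  refine ⟨a, ?_, hle, ⟨w, hwV, fun x hx hx1 => ?_⟩, hint⟩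
  -- Integrality tested on `eᵢ` shows that `a` itself is an integer.
  · obtain ⟨n, hn⟩ := hint _ (h.subset _ (h.pos i))
    rw [Pi.single_eq_same, mul_one] at hn
    rw [hn] at ha0 ha2 ⊢
    have h3 : 0 < n := by exact_mod_cast ha0
    have h4 : n ≤ 2 := by exact_mod_cast ha2
    rcases (by omega : n = 1 ∨ n = 2) with rfl | rfl <;> simp
  · rcases h1 x hx (by rw [dotProduct_one_sub_single]; exact hx1) with hw | ⟨j, hj, hw⟩
    · exact Or.inl hw
    · exact Or.inr ⟨j, by simpa [hj] using hw⟩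

theorem two_mul_int (h : FacetCoordinates V L) {z : ι → ℝ} (hz : z ∈ L) (i : ι) :
    ∃ n : ℤ, 2 * z i = n := by
  obtain ⟨a, rfl | rfl, -, -, hint⟩ := h.exists_adjacent i
  · obtain ⟨n, hn⟩ := hint z hz
    exact ⟨2 * n, by push_cast; linarith⟩
  · exact hint z hz

/-- On the middle layer the adjacent facet gives `a * y i ≥ -1`, and this quantity is a negative
integer. So every such vertex lies on that facet and must be its one new vertex. -/
theorem of_coord_neg (h : FacetCoordinates V L) {x : ι → ℝ} (hx : x ∈ V) (hx0 : ∑ j, x j = 0)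
    {i : ι} (hi : x i < 0) :
    x i = -1 ∧ (∀ y ∈ V, ∑ j, y j = 0 → y i < 0 → y = x) ∧ ∀ z ∈ L, ∃ n : ℤ, z i = n := by
  obtain ⟨a, ha, hle, ⟨w, hw, huniq⟩, hint⟩ := h.exists_adjacent i
  have ha0 : 0 < a := by rcases ha with rfl | rfl <;> norm_num
  have key (y) (hy : y ∈ V) (hy0 : ∑ j, y j = 0) (hyi : y i < 0) : a * y i = -1 ∧ y = w := by
    obtain ⟨n, hn⟩ := hint y (h.subset y hy)
    have h1 := hle y hy
    rw [hy0, hn] at h1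
    have h2 : a * y i < 0 := mul_neg_of_pos_of_neg ha0 hyi
    rw [hn] at h2
    have h3 : n < 0 := by exact_mod_cast h2
    have h4 : -1 ≤ n := by
      have : (-1 : ℝ) ≤ n := by linarith
      exact_mod_cast this
    have h5 : n = -1 := by omega
    have h6 : a * y i = -1 := by rw [hn, h5]; norm_num
    refine ⟨h6, ?_⟩
    rcases huniq y hy (by rw [hy0, h6]; norm_num) with h | ⟨j, h⟩
    · exact h
    · rw [h] at hy0; simp at hy0
  -- If `a = 2`, then `-eᵢ` lies on the adjacent facet too and would have to equal the new vertex,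
  -- which has coordinate sum `0`.
  have ha1 : a = 1 := by
    refine ha.resolve_right fun ha2 => ?_
    rcases huniq _ (h.neg i) (by simp [ha2]; norm_num) with h1 | ⟨j, h1⟩
    · rw [(key x hx hx0 hi).2, ← h1] at hx0; simp at hx0
    · have := congrArg (fun x : ι → ℝ => ∑ j, x j) h1
      simp at this
      norm_num at this
  subst ha1
  refine ⟨by simpa using (key x hx hx0 hi).1, fun y hy hy0 hyi => ?_, fun z hz => ?_⟩
  · rw [(key y hy hy0 hyi).2, (key x hx hx0 hi).2]
  · simpa using hint z hz

theorem of_coord_pos (h : FacetCoordinates V L) {x : ι → ℝ} (hx : x ∈ V) (hx0 : ∑ j, x j = 0)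
    {i : ι} (hi : 0 < x i) :
    x i = 1 ∧ (∀ y ∈ V, ∑ j, y j = 0 → 0 < y i → y = x) ∧ ∀ z ∈ L, ∃ n : ℤ, z i = n := by
  obtain ⟨h1, h2, h3⟩ := h.negate.of_coord_neg (x := -x) (by simpa using hx) (by simp [hx0])
    (i := i) (by simpa using hi)
  refine ⟨by simpa using h1, fun y hy hy0 hyi => ?_, h3⟩
  exact neg_injective (h2 (-y) (by simpa using hy) (by simp [hy0]) (by simpa using hyi))

/-- Otherwise `x s = 0`, and the functional `∑ w - w i - 2 w s` is supporting. It is `1` on `-eₛ`,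
on the `eⱼ` with `j ≠ i, s`, and on both `x` and `y`. That is one vertex too many for a simplex. -/
theorem eq_one_of_neg (h : FacetCoordinates V L) {x y : ι → ℝ} (hx : x ∈ V) (hy : y ∈ V)
    (hx0 : ∑ j, x j = 0) (hy0 : ∑ j, y j = 0) {i : ι} (hxi : x i < 0) (hyi : 0 < y i) {s : ι}
    (hs : y s < 0) : x s = 1 := by
  by_contra hne
  have hxs : x s = 0 := by
    rcases lt_trichotomy (x s) 0 with hlt | heq | hgt
    · have := (h.of_coord_neg hx hx0 hlt).2.1 y hy hy0 hs
      rw [this] at hyi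
      exact absurd hyi hxi.not_gt
    · exact heq
    · exact absurd (h.of_coord_pos hx hx0 hgt).1 hne
  have his : i ≠ s := by rintro rfl; exact absurd hyi hs.not_gt
  have hdot (w : ι → ℝ) : (1 - Pi.single i 1 - Pi.single s 2 : ι → ℝ) ⬝ᵥ w =
      ∑ j, w j - w i - 2 * w s := by
    rw [sub_dotProduct, sub_dotProduct, single_dotProduct, single_dotProduct, one_dotProduct,
      one_mul]
  have hxi1 := (h.of_coord_neg hx hx0 hxi).1
  have hys1 := (h.of_coord_neg hy hy0 hs).1
  have hyi1 := (h.of_coord_pos hy hy0 hyi).1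
  obtain ⟨h1, -⟩ := h.facet (1 - Pi.single i 1 - Pi.single s 2) i x
    (fun j hj => by
      rcases eq_or_ne j s with rfl | hjs
      · right; simp [hj]; norm_num
      · left; simp [hj, hjs]) hx hxi.ne
    (by rw [hdot, hx0, hxi1, hxs]; norm_num)
    (fun w hw => by
      rw [hdot]
      have hint : ∃ n : ℤ, ∑ j, w j = n := h.sum_int w (h.subset w hw)
      obtain ⟨n, hn⟩ := hint
      have hn1 := h.le_one w hw
      have hn2 := h.neg_one_le w hw
      rw [hn] at hn1 hn2
      have hn1' : n ≤ 1 := by exact_mod_cast hn1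
      have hn2' : -1 ≤ n := by exact_mod_cast hn2
      rcases (by omega : n = -1 ∨ n = 0 ∨ n = 1) with rfl | rfl | rfl
      · obtain ⟨j, rfl⟩ := h.eq_neg w hw (by rw [hn]; norm_num)
        rw [hn, Pi.single_apply, Pi.single_apply]
        split_ifs with e1 e2
        · exact absurd (e1.trans e2.symm) his
        all_goals norm_num
      · have hw0 : ∑ j, w j = 0 := by rw [hn]; norm_num
        rw [hw0]
        rcases lt_or_ge (w s) 0 with hlt | hge
        · rw [(h.of_coord_neg hy hy0 hs).2.1 w hw hw0 hlt, hys1, hyi1]; norm_num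
        · rcases lt_or_ge (w i) 0 with hlt | hge'
          · have := (h.of_coord_neg hw hw0 hlt).1
            linarith
          · linarith
      · obtain ⟨j, rfl⟩ := h.eq_pos w hw (by rw [hn]; norm_num)
        rw [hn, Pi.single_apply, Pi.single_apply]
        split_ifs <;> norm_num)
  rcases h1 y hy (by rw [hdot, hy0, hyi1, hys1]; norm_num) with hyx | ⟨j, hj, hyx⟩
  · rw [hyx] at hyi
    exact absurd hyi hxi.not_gt
  · rw [hyx, Pi.single_eq_of_ne hj.symm] at hyi
    exact lt_irrefl _ hyi

/-- The preceding lemma and its negation match negative entries of `y` with entries `1` of `x`, and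
positive entries of `x` with entries `-1` of `y`. This produces an overlap with `x` and `y`
exchanged, which settles the remaining signs. -/
theorem eq_neg_of_overlap (h : FacetCoordinates V L) {x y : ι → ℝ} (hx : x ∈ V) (hy : y ∈ V)
    (hx0 : ∑ j, x j = 0) (hy0 : ∑ j, y j = 0) {i : ι} (hxi : x i < 0) (hyi : 0 < y i) :
    y = -x := by
  have key {x y : ι → ℝ} (hx : x ∈ V) (hy : y ∈ V) (hx0 : ∑ j, x j = 0) (hy0 : ∑ j, y j = 0)
      {i : ι} (hxi : x i < 0) (hyi : 0 < y i) :
      (∀ s, y s < 0 → x s = 1) ∧ ∀ s, 0 < x s → y s = -1 := by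
    refine ⟨fun s hs => h.eq_one_of_neg hx hy hx0 hy0 hxi hyi hs, fun s hs => ?_⟩
    have := h.negate.eq_one_of_neg (x := -y) (y := -x) (by simpa using hy) (by simpa using hx)
      (by simp [hy0]) (by simp [hx0]) (i := i) (by simpa using hyi) (by simpa using hxi) (s := s)
      (by simpa using hs)
    simp only [Pi.neg_apply] at this
    linarith
  obtain ⟨k1, k2⟩ := key hx hy hx0 hy0 hxi hyi
  -- A vector of sum zero with a positive entry also has a negative one.
  obtain ⟨s, hs⟩ : ∃ s, y s < 0 := by
    by_contra! hc
    exact hyi.ne' ((Finset.sum_eq_zero_iff_of_nonneg fun j _ => hc j).1 hy0 i (Finset.mem_univ i))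
  have hs' : 0 < x s := by rw [k1 s hs]; exact one_pos
  obtain ⟨k3, k4⟩ := key hy hx hy0 hx0 hs hs'
  funext t
  rw [Pi.neg_apply]
  rcases lt_trichotomy (x t) 0 with hlt | heq | hgt
  · rw [k3 t hlt, (h.of_coord_neg hx hx0 hlt).1]; norm_num
  · rcases lt_trichotomy (y t) 0 with h1 | h1 | h1
    · have := k1 t h1; rw [heq] at this; norm_num at this
    · rw [h1, heq, neg_zero]
    · have := k4 t h1; rw [heq] at this; norm_num at this
  · rw [k2 t hgt, (h.of_coord_pos hx hx0 hgt).1]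

theorem eq_or_eq_neg_of_overlap (h : FacetCoordinates V L) {x y : ι → ℝ} (hx : x ∈ V) (hy : y ∈ V)
    (hx0 : ∑ j, x j = 0) (hy0 : ∑ j, y j = 0) {i : ι} (hxi : x i ≠ 0) (hyi : y i ≠ 0) :
    y = x ∨ y = -x := by
  rcases hxi.lt_or_gt with h1 | h1 <;> rcases hyi.lt_or_gt with h2 | h2
  · exact Or.inl ((h.of_coord_neg hx hx0 h1).2.1 y hy hy0 h2)
  · exact Or.inr (h.eq_neg_of_overlap hx hy hx0 hy0 h1 h2)
  · right; rw [h.eq_neg_of_overlap hy hx hy0 hx0 h2 h1, neg_neg]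
  · exact Or.inl ((h.of_coord_pos hx hx0 h1).2.1 y hy hy0 h2)

theorem coord_int (h : FacetCoordinates V L) {x : ι → ℝ} (hx : x ∈ V) (hx0 : ∑ j, x j = 0)
    {i : ι} (hi : x i ≠ 0) : (x i = 1 ∨ x i = -1) ∧ ∀ z ∈ L, ∃ n : ℤ, z i = n := by
  rcases hi.lt_or_gt with h1 | h1
  · exact ⟨Or.inr (h.of_coord_neg hx hx0 h1).1, (h.of_coord_neg hx hx0 h1).2.2⟩
  · exact ⟨Or.inl (h.of_coord_pos hx hx0 h1).1, (h.of_coord_pos hx hx0 h1).2.2⟩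

end FacetCoordinates

end Structure

/-! ### Medians -/

section Median

variable {O : Type*} [Fintype O]

/-- Moving the base point from `0` to `s ≥ 0` adds `s` to each term with a nonpositive entry and
costs at most `s` on the others, which are a minority. -/
theorem sum_abs_le_of_card_pos_le {k : ℕ} (hO : Fintype.card O = 2 * k + 1) {y : O → ℤ}
    (hy : (Finset.univ.filter fun o => 0 < y o).card ≤ k) {s : ℝ} (hs : 0 ≤ s) :
    ∑ o, |(y o : ℝ)| ≤ ∑ o, |(y o : ℝ) - s| := by
  have h1 (o : O) : |(y o : ℝ)| + (if 0 < y o then -s else s) ≤ |(y o : ℝ) - s| := by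
    split_ifs with h
    · have : (0 : ℝ) < y o := by exact_mod_cast h
      rw [abs_of_pos this]
      have := le_abs_self ((y o : ℝ) - s)
      linarith
    · have : (y o : ℝ) ≤ 0 := by exact_mod_cast not_lt.1 h
      rw [abs_of_nonpos this, abs_of_nonpos (by linarith)]
      linarith
  have h2 := Finset.sum_le_sum fun o (_ : o ∈ Finset.univ) => h1 o
  rw [Finset.sum_add_distrib, Finset.sum_ite, Finset.sum_const, Finset.sum_const] at h2
  have h3 := Finset.card_filter_add_card_filter_not (s := (Finset.univ : Finset O))
    (fun o => 0 < y o)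
  rw [Finset.card_univ, hO] at h3
  set a := (Finset.univ.filter fun o => 0 < y o).card
  set b := (Finset.univ.filter fun o => ¬ 0 < y o).card
  have hab : (a : ℝ) ≤ b := by exact_mod_cast (by omega : a ≤ b)
  rw [nsmul_eq_mul, nsmul_eq_mul] at h2
  nlinarith [mul_nonneg hs (sub_nonneg.2 hab)]

theorem sum_abs_le_of_card_neg_le {k : ℕ} (hO : Fintype.card O = 2 * k + 1) {y : O → ℤ}
    (hy : (Finset.univ.filter fun o => y o < 0).card ≤ k) {s : ℝ} (hs : s ≤ 0) :
    ∑ o, |(y o : ℝ)| ≤ ∑ o, |(y o : ℝ) - s| := by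
  have := sum_abs_le_of_card_pos_le hO (y := -y) (by simpa using hy) (s := -s) (by linarith)
  convert this using 2 with o _ o _
  · simp
  · rw [← abs_neg]; congr 1; simp; ring

theorem sum_abs_le_of_mem_medianZero {k : ℕ} (hO : Fintype.card O = 2 * k + 1) {y : O → ℤ}
    (hy : y ∈ medianZero O k) (s : ℝ) : ∑ o, |(y o : ℝ)| ≤ ∑ o, |(y o : ℝ) - s| := by
  rcases le_total 0 s with hs | hs
  · exact sum_abs_le_of_card_pos_le hO hy.1 hs
  · exact sum_abs_le_of_card_neg_le hO hy.2 hs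

/-- The median is the least `t` exceeded by at most `k` entries; minimality bounds the number of
entries below `t`. -/
theorem exists_sub_mem_medianZero {k : ℕ} (hO : Fintype.card O = 2 * k + 1) (a : O → ℤ) :
    ∃ t : ℤ, (fun o => a o - t) ∈ medianZero O k := by
  classical
  set p : ℤ → Prop := fun t => (Finset.univ.filter fun o => 0 < a o - t).card ≤ k with hp
  obtain ⟨t, ht, hmin⟩ := Int.exists_least_of_bdd (P := p) (by
    refine ⟨-∑ o, |a o|, fun z hz => ?_⟩
    by_contra! hlt
    have : (Finset.univ.filter fun o => 0 < a o - z) = Finset.univ := by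
      ext o
      have h1 := Finset.single_le_sum (fun o _ => abs_nonneg (a o)) (Finset.mem_univ o)
      have h2 := neg_abs_le (a o)
      simp only [Finset.mem_filter, Finset.mem_univ, true_and, iff_true]
      linarith
    rw [hp] at hz
    simp only [this, Finset.card_univ, hO] at hz
    omega) (by
    refine ⟨∑ o, |a o|, ?_⟩
    have : (Finset.univ.filter fun o => 0 < a o - ∑ o, |a o|) = ∅ := by
      ext o
      have h1 := Finset.single_le_sum (fun o _ => abs_nonneg (a o)) (Finset.mem_univ o)
      have h2 := le_abs_self (a o)
      simp only [Finset.mem_filter, Finset.mem_univ, true_and, Finset.notMem_empty, iff_false]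
      linarith
    simp only [hp, this, Finset.card_empty, zero_le])
  refine ⟨t, ht, ?_⟩
  by_contra! hlt
  have h1 : ¬ p (t - 1) := fun h => by have := hmin _ h; omega
  apply h1
  have h3 := Finset.card_filter_add_card_filter_not (s := (Finset.univ : Finset O))
    (fun o => a o - t < 0)
  rw [Finset.card_univ, hO] at h3
  have h4 : (Finset.univ.filter fun o => ¬ (a o - t < 0)) =
      Finset.univ.filter fun o => 0 < a o - (t - 1) := by
    ext o; simp only [Finset.mem_filter, Finset.mem_univ, true_and]; omega
  rw [h4] at h3
  simp only [hp]
  omega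

/-- Entries of `y'` that are nonnegative become positive in `y`; were both counts at most `k`, at
most `2k` of the `2k + 1` entries would be accounted for. -/
theorem not_card_le_of_add {k : ℕ} (hO : Fintype.card O = 2 * k + 1) {y y' : O → ℤ} {c : ℤ}
    (hc : 0 < c) (hyy : ∀ o, y o = y' o + c)
    (hy : (Finset.univ.filter fun o => 0 < y o).card ≤ k) :
    ¬ (Finset.univ.filter fun o => y' o < 0).card ≤ k := by
  intro hy'
  have h3 := Finset.card_filter_add_card_filter_not (s := (Finset.univ : Finset O))
    (fun o => y' o < 0)
  rw [Finset.card_univ, hO] at h3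
  have h4 : (Finset.univ.filter fun o => ¬ (y' o < 0)).card ≤
      (Finset.univ.filter fun o => 0 < y o).card := by
    refine Finset.card_le_card fun o => ?_
    have := hyy o
    simp only [Finset.mem_filter, Finset.mem_univ, true_and]
    omega
  omega

end Median

/-! ### Normal forms for the integer points of a block -/

section BlockSet

variable {J : Type*} [Fintype J] {k : ℕ}

open Classical in
/-- The parameters of the lattice points of a block. -/
noncomputable def blockSet (J : Type*) [Fintype J] (k : ℕ) (two : Prop) : Set (Option J → ℤ) :=
  if two then medianZero (Option J) k else oneSided J k

/-- The normalized `h`-polynomial of a block. -/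
noncomputable def blockGF (k : ℕ) (two : Prop) : ℝ[X] :=
  open Classical in
  if two then blockPoly k
  else Polynomial.C (1 / 2 : ℝ) * (blockPoly k + (1 + Polynomial.X) ^ (2 * k))

theorem gammaCone_blockGF (k : ℕ) (two : Prop) : GammaCone (2 * k) (blockGF k two) := by
  unfold blockGF
  split_ifs
  · exact gammaCone_blockPoly k
  · exact gammaCone_oneSided k

theorem hasGF_blockSet (hJ : Fintype.card J = 2 * k) (two : Prop) :
    HasGF (blockSet J k two) (fun y => ∑ o, (y o).natAbs)
      ((blockGF k two : ℝ⟦X⟧) * geom ^ (2 * k)) := by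
  unfold blockSet blockGF
  split_ifs
  · exact hasGF_medianZero (by rw [Fintype.card_option, hJ])
  · exact hasGF_oneSided hJ

/-- The choice `t = -y none` is optimal. In the one-sided set, either the median is zero, or `y none
= 0` and only base points `t ≥ 0` compete. -/
theorem sum_abs_le_of_mem_blockSet (hJ : Fintype.card J = 2 * k) {two : Prop} {y : Option J → ℤ}
    (hy : y ∈ blockSet J k two) {t : ℝ} (ht : ¬ two → 0 ≤ t) :
    ∑ o, |(y o : ℝ)| ≤ ∑ o, |(y o : ℝ) - (t + y none)| := by
  have hO : Fintype.card (Option J) = 2 * k + 1 := by rw [Fintype.card_option, hJ]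
  unfold blockSet at hy
  split_ifs at hy with h
  · exact sum_abs_le_of_mem_medianZero hO hy _
  · rcases hy.1.lt_or_eq with h0 | h0
    · exact sum_abs_le_of_mem_medianZero hO ⟨hy.2.1, hy.2.2 h0⟩ _
    · exact sum_abs_le_of_card_pos_le hO hy.2.1 (by rw [h0]; simpa using ht h)

theorem none_nonpos_of_mem_blockSet {two : Prop} {y : Option J → ℤ} (hy : y ∈ blockSet J k two)
    (h : ¬ two) : y none ≤ 0 := by
  rw [blockSet, if_neg h] at hy
  exact hy.1

theorem exists_mem_blockSet (hJ : Fintype.card J = 2 * k) (two : Prop) (a : J → ℤ) :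
    ∃ y ∈ blockSet J k two, ∀ j, y (some j) - y none = a j := by
  have hO : Fintype.card (Option J) = 2 * k + 1 := by rw [Fintype.card_option, hJ]
  obtain ⟨t, ht⟩ := exists_sub_mem_medianZero hO (fun o : Option J => o.elim 0 a)
  by_cases h : two
  · refine ⟨_, by rw [blockSet, if_pos h]; exact ht, fun j => by simp⟩
  · rcases lt_or_ge 0 t with h0 | h0
    · refine ⟨fun o : Option J => o.elim 0 a - t, ?_, fun j => by simp⟩
      rw [blockSet, if_neg h]
      exact ⟨by simp; omega, ht.1, fun _ => ht.2⟩
    -- The median is not positive, so the sign constraint is active and the best admissible shift is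
    -- `0`.
    · refine ⟨fun o : Option J => o.elim 0 a, ?_, fun j => by simp⟩
      rw [blockSet, if_neg h]
      refine ⟨by simp, le_trans (Finset.card_le_card fun o => ?_) ht.1, fun h => by simp at h⟩
      simp only [Finset.mem_filter, Finset.mem_univ, true_and]
      omega

theorem eq_of_mem_blockSet (hJ : Fintype.card J = 2 * k) {two : Prop} {y y' : Option J → ℤ}
    (hy : y ∈ blockSet J k two) (hy' : y' ∈ blockSet J k two)
    (h : ∀ j, y (some j) - y none = y' (some j) - y' none) : y = y' := by
  have hO : Fintype.card (Option J) = 2 * k + 1 := by rw [Fintype.card_option, hJ]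
  have key {y y' : Option J → ℤ} (hy : y ∈ blockSet J k two) (hy' : y' ∈ blockSet J k two)
      (h : ∀ j, y (some j) - y none = y' (some j) - y' none) : ¬ y' none < y none := by
    intro hlt
    have hyy (o : Option J) : y o = y' o + (y none - y' none) := by
      cases o with
      | none => ring
      | some j => have := h j; omega
    unfold blockSet at hy hy'
    split_ifs at hy hy'
    · exact not_card_le_of_add hO (by omega) hyy hy.1 hy'.2
    · exact not_card_le_of_add hO (by omega) hyy hy.2.1 (hy'.2.2 (by have := hy.1; omega))
  have h1 := key hy hy' h
  have h2 := key hy' hy fun j => (h j).symm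
  have h3 : y none = y' none := by omega
  funext o
  cases o with
  | none => exact h3
  | some j => have := h j; omega

end BlockSet

/-- The extra geometric factor is a slack variable: it turns points of weight exactly `m` into
points of weight at most `m`. -/
theorem HasGF.coeff_mul_geom {α : Type*} {s : Set α} {w : α → ℕ} {F : ℝ⟦X⟧} (h : HasGF s w F)
    (m : ℕ) : {a ∈ s | w a ≤ m}.Finite ∧
      PowerSeries.coeff m (F * geom) = ({a ∈ s | w a ≤ m}.ncard : ℝ) := by
  obtain ⟨h1, h2⟩ := (h.prod hasGF_nat) m
  have himg : {a ∈ s | w a ≤ m} =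
      Prod.fst '' {a ∈ s ×ˢ (Set.univ : Set ℕ) | w a.1 + id a.2 = m} := by
    ext a
    simp only [Set.mem_ofPred_eq, Set.mem_image, Set.mem_prod, Set.mem_univ, and_true, id]
    constructor
    · rintro ⟨ha, hw⟩
      exact ⟨(a, m - w a), ⟨ha, by simp; omega⟩, rfl⟩
    · rintro ⟨p, ⟨hp, hw⟩, rfl⟩
      exact ⟨hp, by omega⟩
  rw [himg, Set.InjOn.ncard_image]
  · exact ⟨h1.image _, h2⟩
  · rintro ⟨a, n⟩ ⟨_, ha⟩ ⟨b, n'⟩ ⟨_, hb⟩ hab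
    simp only [id] at ha hb hab
    subst hab
    ext
    · rfl
    · simp only; omega

/-! ### Lattice points in a free sum of blocks -/

section Blocks

variable {ι κ : Type*} [Fintype ι] [DecidableEq ι] [Fintype κ] [DecidableEq κ]
  (β : ι → Option κ) (σ : ι → ℤ) (two : κ → Prop) (k : κ → ℕ)

/-- The vector supported on the block `r`, with signs `σ`. -/
def blockVector (r : κ) : ι → ℝ := fun i => if β i = some r then (σ i : ℝ) else 0

/-- Membership in the `m`-th dilate of the polytope spanned by the vectors `± eᵢ`, the block
vectors, and the negatives of the block vectors of the two-sided blocks. -/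
def InDilate (m : ℝ) (z : ι → ℝ) : Prop :=
  ∃ t : κ → ℝ, (∀ r, ¬ two r → 0 ≤ t r) ∧
    ∑ i, |z i - ∑ r, t r * blockVector β σ r i| + ∑ r, |t r| ≤ m

/-- Parameters for lattice points: one integer for each free coordinate and one vector for
each block. -/
abbrev BlockParam : Type _ :=
  ({i // β i = none} → ℤ) × (∀ r : κ, Option {i // β i = some r} → ℤ)

/-- The admissible parameters. -/
def paramSet : Set (BlockParam β) :=
  Set.univ ×ˢ Set.univ.pi fun r => blockSet {i // β i = some r} (k r) (two r)

/-- The weight of a parameter, for points in the coset of `C`. -/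
def paramWeight (C : Finset ι) (p : BlockParam β) : ℕ :=
  ((∑ i, if i.1 ∈ C then halfAbs (p.1 i) else (p.1 i).natAbs) + ∑ r, ∑ o, (p.2 r o).natAbs) +
    C.card / 2

/-- The point with given parameters in the coset of `C`. -/
noncomputable def paramPoint (C : Finset ι) (p : BlockParam β) : ι → ℝ := fun i =>
  match h : β i with
  | none => p.1 ⟨i, h⟩ + if i ∈ C then 1 / 2 else 0
  | some r => σ i * (p.2 r (some ⟨i, h⟩) - p.2 r none)

/-- The `h`-polynomial contributed by the coset of `C`. -/
noncomputable def cosetPoly (C : Finset ι) : ℝ[X] :=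
  Polynomial.X ^ (C.card / 2) * ((∏ i : {i // β i = none},
    if i.1 ∈ C then Polynomial.C 2 else 1 + Polynomial.X) * ∏ r, blockGF (k r) (two r))

/-- Points congruent modulo `ℤ^ι` to half the indicator vector of `C`. -/
def cosetSet (C : Finset ι) : Set (ι → ℝ) :=
  {z | ∀ i, ∃ n : ℤ, z i = n + if i ∈ C then 1 / 2 else 0}

theorem paramPoint_free (C : Finset ι) (p : BlockParam β) (i : {i // β i = none}) :
    paramPoint β σ C p i = p.1 i + if i.1 ∈ C then 1 / 2 else 0 := by
  obtain ⟨i, hi⟩ := i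
  unfold paramPoint
  split
  · rfl
  · rename_i r h; rw [hi] at h; cases h

theorem paramPoint_block (C : Finset ι) (p : BlockParam β) (r : κ) (i : {i // β i = some r}) :
    paramPoint β σ C p i = σ i * (p.2 r (some i) - p.2 r none) := by
  obtain ⟨i, hi⟩ := i
  unfold paramPoint
  split
  · rename_i h; rw [hi] at h; cases h
  · rename_i r' h
    obtain rfl : r = r' := by rw [hi] at h; exact Option.some_injective _ h
    rfl

theorem sum_blocks (f : ι → ℝ) : ∑ i, f i = ∑ i : {i // β i = none}, f i +
    ∑ r, ∑ i : {i // β i = some r}, f i := by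
  rw [← Fintype.sum_fiberwise β f, Fintype.sum_option]

theorem card_blocks (hk : ∀ r, Fintype.card {i // β i = some r} = 2 * k r) :
    Fintype.card ι = Fintype.card {i // β i = none} + ∑ r, 2 * k r := by
  have := sum_blocks β fun _ => 1
  simp only [Finset.sum_const, Finset.card_univ, nsmul_eq_mul, mul_one, hk] at this
  exact_mod_cast this

variable {β σ two k}

/-- The penalty `|t r|` is read as the term of an extra coordinate `none`, so each block becomes an
`ℓ¹` distance from an integer vector to a constant one. -/
theorem sum_abs_sub_blockVector (hσ : ∀ i, σ i = 1 ∨ σ i = -1) (C : Finset ι) (p : BlockParam β)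
    (t : κ → ℝ) :
    ∑ i, |paramPoint β σ C p i - ∑ r, t r * blockVector β σ r i| + ∑ r, |t r| =
      ∑ i : {i // β i = none}, |(p.1 i : ℝ) + if i.1 ∈ C then 1 / 2 else 0| +
        ∑ r, ∑ o, |(p.2 r o : ℝ) - (t r + p.2 r none)| := by
  rw [sum_blocks β, add_assoc, ← Finset.sum_add_distrib]
  congr 1
  · refine Finset.sum_congr rfl fun i _ => ?_
    rw [paramPoint_free]
    simp [blockVector, i.2]
  · refine Finset.sum_congr rfl fun r _ => ?_
    rw [Fintype.sum_option, add_comm]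
    congr 1
    · rw [← abs_neg]; congr 1; ring
    · refine Finset.sum_congr rfl fun i _ => ?_
      rw [paramPoint_block]
      have : ∑ r', t r' * blockVector β σ r' i.1 = σ i * t r := by
        rw [Finset.sum_eq_single r]
        · simp [blockVector, i.2, mul_comm]
        · intro r' _ hr
          simp [blockVector, i.2, hr.symm]
        · simp
      rw [this, ← mul_sub, abs_mul]
      have : |(σ i : ℝ)| = 1 := by rcases hσ i with h | h <;> simp [h]
      rw [this, one_mul]
      congr 1
      ring

theorem halfAbs_cast (y : ℤ) : |(y : ℝ) + 1 / 2| = halfAbs y + 1 / 2 := by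
  unfold halfAbs
  split_ifs with h
  · have h1 : (0 : ℝ) ≤ y := by exact_mod_cast h
    have h2 : ((y.toNat : ℤ) : ℝ) = y := by rw [Int.toNat_of_nonneg h]
    rw [Int.cast_natCast] at h2
    rw [abs_of_nonneg (by linarith), h2]
  · have h1 : (y : ℝ) ≤ -1 := by exact_mod_cast (by omega : y ≤ -1)
    have h2 : (((-y - 1).toNat : ℤ) : ℝ) = -y - 1 := by
      rw [Int.toNat_of_nonneg (by omega)]; push_cast; ring
    rw [Int.cast_natCast] at h2
    rw [abs_of_nonpos (by linarith), h2]
    ring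

/-- Each half-integral coordinate is `halfAbs` plus `1 / 2` in absolute value. Evenness of `C.card`
makes the total of these halves the natural number `C.card / 2`. -/
theorem paramWeight_cast {C : Finset ι} (hC : ∀ i ∈ C, β i = none) (hC2 : Even C.card)
    (p : BlockParam β) : (paramWeight β C p : ℝ) =
      ∑ i : {i // β i = none}, |(p.1 i : ℝ) + if i.1 ∈ C then 1 / 2 else 0| +
        ∑ r, ∑ o, |(p.2 r o : ℝ)| := by
  have h1 : ∑ i : {i // β i = none}, |(p.1 i : ℝ) + if i.1 ∈ C then 1 / 2 else 0| =
      ∑ i : {i // β i = none}, ((if i.1 ∈ C then halfAbs (p.1 i) else (p.1 i).natAbs : ℕ) : ℝ) +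
      ∑ i : {i // β i = none}, if i.1 ∈ C then (1 / 2 : ℝ) else 0 := by
    rw [← Finset.sum_add_distrib]
    refine Finset.sum_congr rfl fun i _ => ?_
    split_ifs
    · exact halfAbs_cast _
    · simp
  have h2 : ∑ i : {i // β i = none}, (if i.1 ∈ C then (1 / 2 : ℝ) else 0) =
      ((C.card / 2 : ℕ) : ℝ) := by
    have h3 := sum_blocks β fun i => if i ∈ C then (1 / 2 : ℝ) else 0
    have h4 : ∑ r, ∑ i : {i // β i = some r}, (if i.1 ∈ C then (1 / 2 : ℝ) else 0) = 0 := by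
      refine Finset.sum_eq_zero fun r _ => Finset.sum_eq_zero fun i _ => ?_
      rw [if_neg]
      intro h
      have := hC _ h
      rw [i.2] at this
      cases this
    rw [h4, add_zero] at h3
    rw [← h3, Finset.sum_ite_mem, Finset.univ_inter, Finset.sum_const, nsmul_eq_mul,
      Nat.cast_div hC2.two_dvd (by norm_num)]
    push_cast
    ring
  rw [h1, h2, paramWeight]
  push_cast
  simp only [Nat.cast_natAbs, Int.cast_abs]
  ring

/-- Minimizing over `t` splits block by block, and the minimum is attained at `t r = -y none`; so
the gauge of the point is its weight. -/
theorem inDilate_paramPoint (hσ : ∀ i, σ i = 1 ∨ σ i = -1)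
    (hk : ∀ r, Fintype.card {i // β i = some r} = 2 * k r)
    {C : Finset ι} (hC : ∀ i ∈ C, β i = none) (hC2 : Even C.card)
    {p : BlockParam β} (hp : p ∈ paramSet β two k) (m : ℕ) :
    InDilate β σ two m (paramPoint β σ C p) ↔ paramWeight β C p ≤ m := by
  have hp2 (r : κ) := hp.2 r (Set.mem_univ r)
  rw [← Nat.cast_le (α := ℝ), paramWeight_cast hC hC2]
  constructor
  · rintro ⟨t, ht, hle⟩
    rw [sum_abs_sub_blockVector hσ] at hle
    refine le_trans ?_ hle
    refine add_le_add le_rfl (Finset.sum_le_sum fun r _ => ?_)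
    exact sum_abs_le_of_mem_blockSet (hk r) (hp2 r) (ht r)
  · intro h
    refine ⟨fun r => -p.2 r none, fun r hr => ?_, ?_⟩
    · have := none_nonpos_of_mem_blockSet (hp2 r) hr
      simpa using (by exact_mod_cast this : (p.2 r none : ℝ) ≤ 0)
    · rw [sum_abs_sub_blockVector hσ]
      simpa using h

theorem bijOn_paramPoint (hσ : ∀ i, σ i = 1 ∨ σ i = -1)
    (hk : ∀ r, Fintype.card {i // β i = some r} = 2 * k r)
    {C : Finset ι} (hC : ∀ i ∈ C, β i = none) :
    Set.BijOn (paramPoint β σ C) (paramSet β two k) (cosetSet C) := by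
  have hσ2 (i : ι) : (σ i : ℝ) * σ i = 1 := by rcases hσ i with h | h <;> simp [h]
  have hblk {r : κ} (i : {i // β i = some r}) : i.1 ∉ C := fun h => by
    have := hC _ h
    rw [i.2] at this
    cases this
  refine ⟨fun p hp i => ?_, fun p hp p' hp' heq => ?_, fun z hz => ?_⟩
  · rcases hβ : β i with _ | r
    · exact ⟨p.1 ⟨i, hβ⟩, paramPoint_free β σ C p ⟨i, hβ⟩⟩
    · refine ⟨σ i * (p.2 r (some ⟨i, hβ⟩) - p.2 r none), ?_⟩
      rw [paramPoint_block β σ C p r ⟨i, hβ⟩, if_neg (hblk ⟨i, hβ⟩)]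
      push_cast
      ring
  · refine Prod.ext (funext fun i => ?_) (funext fun r => ?_)
    · have := congrFun heq i
      rw [paramPoint_free, paramPoint_free] at this
      exact_mod_cast add_right_cancel this
    · refine eq_of_mem_blockSet (hk r) (hp.2 r (Set.mem_univ r)) (hp'.2 r (Set.mem_univ r))
        fun i => ?_
      have := congrFun heq i
      rw [paramPoint_block, paramPoint_block] at this
      have h0 : (σ i : ℝ) ≠ 0 := left_ne_zero_of_mul_eq_one (hσ2 i)
      exact_mod_cast mul_left_cancel₀ h0 this
  · choose n hn using hz
    choose y hy hyn using fun r => exists_mem_blockSet (hk r) (two r)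
      (fun i : {i // β i = some r} => σ i * n i)
    refine ⟨⟨fun i => n i, y⟩, ⟨trivial, fun r _ => hy r⟩, funext fun i => ?_⟩
    rcases hβ : β i with _ | r
    · rw [paramPoint_free β σ C _ ⟨i, hβ⟩, hn i]
    · rw [paramPoint_block β σ C _ r ⟨i, hβ⟩, hn i, if_neg (hblk ⟨i, hβ⟩)]
      have : (y r (some ⟨i, hβ⟩) : ℝ) - y r none = σ i * n i := by exact_mod_cast hyn r ⟨i, hβ⟩
      rw [this, ← mul_assoc, hσ2]
      ring

theorem hasGF_paramSet (hk : ∀ r, Fintype.card {i // β i = some r} = 2 * k r) (C : Finset ι) :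
    HasGF (paramSet β two k) (paramWeight β C)
      ((cosetPoly β two k C : ℝ⟦X⟧) * geom ^ Fintype.card ι) := by
  have h1 : HasGF (Set.univ : Set ({i // β i = none} → ℤ))
      (fun n => ∑ i, if i.1 ∈ C then halfAbs (n i) else (n i).natAbs)
      (∏ i : {i // β i = none}, (if i.1 ∈ C then 2 else 1 + PowerSeries.X) * geom) := by
    have := HasGF.pi (fun _ : {i // β i = none} => (Set.univ : Set ℤ))
      (fun i y => if i.1 ∈ C then halfAbs y else y.natAbs)
      (fun i => (if i.1 ∈ C then 2 else 1 + PowerSeries.X) * geom) (fun i => by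
        split_ifs
        · exact hasGF_halfAbs
        · exact hasGF_int)
    rwa [Set.pi_univ] at this
  have h2 := HasGF.pi _ _ _ fun r => hasGF_blockSet (hk r) (two r)
  have h3 := (h1.prod h2).add_const (C.card / 2)
  refine (congrArg (HasGF (paramSet β two k) (paramWeight β C)) ?_).mpr h3
  rw [card_blocks β k hk, cosetPoly]
  have hc : ((Polynomial.C 2 : ℝ[X]) : ℝ⟦X⟧) = 2 := by
    rw [Polynomial.coe_C]; exact map_ofNat _ 2
  simp only [← Polynomial.coeToPowerSeries.ringHom_apply, map_mul, map_prod, map_pow, apply_ite,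
    map_add, map_one]
  simp only [Polynomial.coeToPowerSeries.ringHom_apply, hc, Polynomial.coe_X,
    Finset.prod_mul_distrib, Finset.prod_const, Finset.card_univ, Finset.prod_pow_eq_pow_sum]
  ring

/-- The free coordinates give `2^|C| X^(|C|/2) (1 + X)^(n - |C|)`, where `n` is their number. This
is a nonnegative multiple of a basis element with center `n / 2`, independent of `C`. -/
theorem gammaCone_cosetPoly (hk : ∀ r, Fintype.card {i // β i = some r} = 2 * k r)
    {C : Finset ι} (hC : ∀ i ∈ C, β i = none) (hC2 : Even C.card) :
    GammaCone (Fintype.card ι) (cosetPoly β two k C) := by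
  rw [card_blocks β k hk, cosetPoly, ← mul_assoc]
  refine GammaCone.mul ?_ (GammaCone.prod fun r _ => gammaCone_blockGF _ _)
  rw [Finset.prod_ite, Finset.prod_const, Finset.prod_const]
  have hcard : (Finset.univ.filter fun i : {i // β i = none} => i.1 ∈ C).card = C.card := by
    rw [← Finset.card_map (Function.Embedding.subtype _)]
    congr 1
    ext i
    simp only [Finset.mem_map, Finset.mem_filter, Finset.mem_univ, true_and,
      Function.Embedding.subtype_apply, Subtype.exists, exists_and_right, exists_eq_right]
    exact ⟨fun ⟨_, h⟩ => h, fun h => ⟨hC i h, h⟩⟩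
  have htot := Finset.card_filter_add_card_filter_not
    (s := (Finset.univ : Finset {i // β i = none})) (fun i => i.1 ∈ C)
  rw [Finset.card_univ] at htot
  obtain ⟨c, hc⟩ := hC2
  have := GammaCone.basis (n := Fintype.card {i // β i = none}) (i := C.card / 2)
    (c := (2 : ℝ) ^ C.card) (by positivity) (by omega)
  convert this using 1
  rw [hcard] at htot ⊢
  rw [show Fintype.card {i // β i = none} - 2 * (C.card / 2) =
    (Finset.univ.filter fun i : {i // β i = none} => i.1 ∉ C).card by omega, Polynomial.C_pow]
  ring

theorem coeff_cosetPoly (hσ : ∀ i, σ i = 1 ∨ σ i = -1)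
    (hk : ∀ r, Fintype.card {i // β i = some r} = 2 * k r)
    {C : Finset ι} (hC : ∀ i ∈ C, β i = none) (hC2 : Even C.card) (m : ℕ) :
    {z ∈ cosetSet C | InDilate β σ two m z}.Finite ∧
    PowerSeries.coeff m ((cosetPoly β two k C : ℝ⟦X⟧) * geom ^ (Fintype.card ι + 1)) =
      ({z ∈ cosetSet C | InDilate β σ two m z}.ncard : ℝ) := by
  have hb := bijOn_paramPoint (two := two) hσ hk hC
  obtain ⟨h1, h2⟩ := (hasGF_paramSet (two := two) hk C).coeff_mul_geom m
  have himg : {z ∈ cosetSet C | InDilate β σ two m z} =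
      paramPoint β σ C '' {p ∈ paramSet β two k | paramWeight β C p ≤ m} := by
    ext z
    constructor
    · rintro ⟨hz, hm⟩
      obtain ⟨p, hp, rfl⟩ := hb.surjOn hz
      exact ⟨p, ⟨hp, (inDilate_paramPoint hσ hk hC hC2 hp m).1 hm⟩, rfl⟩
    · rintro ⟨p, ⟨hp, hm⟩, rfl⟩
      exact ⟨hb.mapsTo hp, (inDilate_paramPoint hσ hk hC hC2 hp m).2 hm⟩
  rw [himg, Set.InjOn.ncard_image (hb.injOn.mono fun p hp => hp.1), pow_succ, ← mul_assoc]
  exact ⟨h1.image _, h2⟩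

/-- The Ehrhart series of a free sum of blocks with respect to a lattice. -/
theorem exists_gammaCone_of_blocks (hσ : ∀ i, σ i = 1 ∨ σ i = -1)
    (hk : ∀ r, Fintype.card {i // β i = some r} = 2 * k r)
    {L : AddSubgroup (ι → ℝ)} (hsingle : ∀ i, Pi.single i 1 ∈ L)
    (hsum : ∀ z ∈ L, ∃ n : ℤ, ∑ i, z i = n) (hhalf : ∀ z ∈ L, ∀ i, ∃ n : ℤ, 2 * z i = n)
    (hint : ∀ z ∈ L, ∀ i, β i ≠ none → ∃ n : ℤ, z i = n) :
    ∃ f : ℝ[X], GammaCone (Fintype.card ι) f ∧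
      (PowerSeries.mk fun m : ℕ => ({z | z ∈ L ∧ InDilate β σ two m z}.ncard : ℝ)) =
        f * geom ^ (Fintype.card ι + 1) := by
  classical
  let ind (C : Finset ι) : ι → ℝ := fun i => if i ∈ C then 1 / 2 else 0
  have hZ (n : ι → ℤ) : (fun i => (n i : ℝ)) ∈ L := by
    have : (fun i => (n i : ℝ)) = ∑ i, n i • (Pi.single i 1 : ι → ℝ) := by
      ext i
      simp [Finset.sum_apply, Pi.single_apply]
    rw [this]
    exact L.sum_mem fun i _ => L.zsmul_mem (hsingle i) _
  have hcos {C : Finset ι} {z : ι → ℝ} (hz : z ∈ cosetSet C) : z ∈ L ↔ ind C ∈ L := by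
    choose n hn using hz
    have : z = (fun i => (n i : ℝ)) + ind C := funext hn
    rw [this]
    exact L.add_mem_cancel_left (hZ n)
  let 𝒞 : Finset (Finset ι) := Finset.univ.filter fun C => ind C ∈ L
  -- Lattice points are integral on block coordinates, which rules out an entry `1 / 2` there.
  have hC1 (C) (hC : C ∈ 𝒞) : ∀ i ∈ C, β i = none := by
    intro i hi
    by_contra hne
    obtain ⟨n, hn⟩ := hint _ (Finset.mem_filter.1 hC).2 i hne
    simp only [ind, if_pos hi] at hn
    have h2 : ((2 * n : ℤ) : ℝ) = (1 : ℤ) := by push_cast; linarith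
    have h3 : 2 * n = 1 := by exact_mod_cast h2
    omega
  -- The coordinate sum of the half indicator is `C.card / 2`, and it must be an integer.
  have hC2 (C) (hC : C ∈ 𝒞) : Even C.card := by
    obtain ⟨n, hn⟩ := hsum _ (Finset.mem_filter.1 hC).2
    simp only [ind, Finset.sum_ite_mem, Finset.univ_inter, Finset.sum_const, nsmul_eq_mul] at hn
    have h2 : ((C.card : ℤ) : ℝ) = (2 * n : ℤ) := by push_cast; linarith
    have h3 : (C.card : ℤ) = 2 * n := by exact_mod_cast h2
    exact ⟨n.toNat, by omega⟩
  refine ⟨∑ C ∈ 𝒞, cosetPoly β two k C,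
    GammaCone.sum fun C hC => gammaCone_cosetPoly hk (hC1 C hC) (hC2 C hC), ?_⟩
  ext m
  have hset : {z | z ∈ L ∧ InDilate β σ two m z} =
      ⋃ C ∈ 𝒞, {z ∈ cosetSet C | InDilate β σ two m z} := by
    ext z
    simp only [Set.mem_ofPred_eq, Set.mem_iUnion, exists_prop]
    constructor
    · rintro ⟨hz, hm⟩
      choose n hn using hhalf z hz
      -- The coset of `z` is read off from the parities of the integers `2 z i`.
      let C : Finset ι := Finset.univ.filter fun i => n i % 2 = 1
      have hzC : z ∈ cosetSet C := by
        intro i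
        refine ⟨n i / 2, ?_⟩
        have h1 : ((n i : ℤ) : ℝ) = (2 * (n i / 2) + n i % 2 : ℤ) := by
          rw [Int.mul_ediv_add_emod]
        have h2 := hn i
        rw [h1] at h2
        by_cases h : n i % 2 = 1
        · rw [if_pos (by simp [C, h])]
          rw [h] at h2
          push_cast at h2
          linarith
        · rw [if_neg (by simp [C, h])]
          rw [show n i % 2 = 0 by omega] at h2
          push_cast at h2
          linarith
      exact ⟨C, Finset.mem_filter.2 ⟨Finset.mem_univ _, (hcos hzC).1 hz⟩, hzC, hm⟩
    · rintro ⟨C, hC, hzC, hm⟩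
      exact ⟨(hcos hzC).2 (Finset.mem_filter.1 hC).2, hm⟩
  have hdis : (𝒞 : Set (Finset ι)).PairwiseDisjoint
      fun C => {z ∈ cosetSet C | InDilate β σ two m z} := by
    intro C _ D _ hne
    rw [Function.onFun, Set.disjoint_left]
    rintro z ⟨hzC, -⟩ ⟨hzD, -⟩
    apply hne
    ext i
    obtain ⟨a, ha⟩ := hzC i
    obtain ⟨b, hb⟩ := hzD i
    rw [ha] at hb
    by_cases h1 : i ∈ C <;> by_cases h2 : i ∈ D <;> simp only [h1, h2, if_true, if_false] at hb ⊢
    all_goals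
      exfalso
      first
      | have h3 : ((2 * a + 1 : ℤ) : ℝ) = (2 * b : ℤ) := by push_cast; linarith
        have h4 : 2 * a + 1 = 2 * b := by exact_mod_cast h3
        omega
      | have h3 : ((2 * a : ℤ) : ℝ) = (2 * b + 1 : ℤ) := by push_cast; linarith
        have h4 : 2 * a = 2 * b + 1 := by exact_mod_cast h3
        omega
  have hfin (C) (hC : C ∈ 𝒞) := coeff_cosetPoly (two := two) hσ hk (hC1 C hC) (hC2 C hC) m
  have hcard := 𝒞.finite_toSet.ncard_biUnion (fun C hC => (hfin C hC).1) hdis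
  rw [finsum_mem_coe_finset] at hcard
  simp only [Finset.mem_coe] at hcard
  rw [PowerSeries.coeff_mk, hset, hcard, ← Polynomial.coeToPowerSeries.ringHom_apply, map_sum, Finset.sum_mul, map_sum]
  push_cast
  exact Finset.sum_congr rfl fun C hC => (hfin C hC).2.symm

end Blocks

/-! ### The gauge description of the convex hull -/

section ConvexHull

variable {ι κ : Type*} [Fintype ι] [DecidableEq ι] [Fintype κ] [DecidableEq κ]
  {β : ι → Option κ} {σ : ι → ℤ} {two : κ → Prop}

theorem InDilate.add {a b : ℝ} {z w : ι → ℝ} (hz : InDilate β σ two a z)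
    (hw : InDilate β σ two b w) : InDilate β σ two (a + b) (z + w) := by
  obtain ⟨t, ht, hle⟩ := hz
  obtain ⟨s, hs, hle'⟩ := hw
  refine ⟨t + s, fun r hr => add_nonneg (ht r hr) (hs r hr), ?_⟩
  have key (i : ι) : |(z + w) i - ∑ r, (t + s) r * blockVector β σ r i| ≤
      |z i - ∑ r, t r * blockVector β σ r i| + |w i - ∑ r, s r * blockVector β σ r i| := by
    refine le_trans (le_of_eq (congrArg abs ?_)) (abs_add_le _ _)
    simp only [Pi.add_apply, add_mul, Finset.sum_add_distrib]
    ring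
  refine le_trans (add_le_add (Finset.sum_le_sum fun i _ => key i)
    (Finset.sum_le_sum fun r _ => abs_add_le (t r) (s r))) ?_
  rw [Finset.sum_add_distrib, Finset.sum_add_distrib]
  linarith

theorem InDilate.smul {a c : ℝ} (hc : 0 ≤ c) {z : ι → ℝ} (hz : InDilate β σ two a z) :
    InDilate β σ two (c * a) (c • z) := by
  obtain ⟨t, ht, hle⟩ := hz
  refine ⟨c • t, fun r hr => mul_nonneg hc (ht r hr), ?_⟩
  refine le_trans (le_of_eq ?_) (mul_le_mul_of_nonneg_left hle hc)
  rw [mul_add, Finset.mul_sum, Finset.mul_sum]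
  congr 1
  · refine Finset.sum_congr rfl fun i _ => ?_
    rw [← abs_of_nonneg hc, ← abs_mul, abs_of_nonneg hc, mul_sub, Finset.mul_sum]
    simp [mul_assoc]
  · refine Finset.sum_congr rfl fun r _ => ?_
    rw [Pi.smul_apply, smul_eq_mul, abs_mul, abs_of_nonneg hc]

theorem inDilate_single (i : ι) {c : ℝ} (hc : |c| = 1) :
    InDilate β σ two 1 (Pi.single i c) := by
  refine ⟨0, by simp, le_of_eq ?_⟩
  simp only [Pi.zero_apply, zero_mul, Finset.sum_const_zero, sub_zero, abs_zero, add_zero]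
  rw [Finset.sum_eq_single i]
  · simpa using hc
  · intro j _ hj; simp [hj]
  · simp

theorem inDilate_blockVector (r : κ) {c : ℝ} (hc : |c| = 1) (h : ¬ two r → 0 ≤ c) :
    InDilate β σ two 1 (c • blockVector β σ r) := by
  refine ⟨Pi.single r c, fun r' hr' => ?_, le_of_eq ?_⟩
  · rcases eq_or_ne r' r with rfl | hne
    · simpa using h hr'
    · simp [hne]
  · have (i : ι) : ∑ r', (Pi.single r c : κ → ℝ) r' * blockVector β σ r' i =
        c * blockVector β σ r i := by
      rw [Finset.sum_eq_single r]
      · simp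
      · intro j _ hj; simp [hj]
      · simp
    simp only [this, Pi.smul_apply, smul_eq_mul, sub_self, abs_zero, Finset.sum_const_zero,
      zero_add]
    rw [Finset.sum_eq_single r]
    · simpa using hc
    · intro j _ hj; simp [hj]
    · simp

theorem sum_mem_smul_of_convex {E α : Type*} [AddCommGroup E] [Module ℝ E] {K : Set E}
    (hK : Convex ℝ K) (h0 : (0 : E) ∈ K) (T : Finset α) {f : α → E} {a : α → ℝ}
    (ha : ∀ i, 0 ≤ a i) (hf : ∀ i, f i ∈ a i • K) : ∑ i ∈ T, f i ∈ (∑ i ∈ T, a i) • K := by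
  classical
  induction T using Finset.induction_on with
  | empty => simpa using Set.smul_mem_smul_set (a := (0 : ℝ)) h0
  | insert i T hi ih =>
    rw [Finset.sum_insert hi, Finset.sum_insert hi,
      hK.add_smul (ha i) (Finset.sum_nonneg fun i _ => ha i)]
    exact Set.add_mem_add (hf i) ih

/-- In one direction the unit gauge set is convex and contains the vertices. In the other, a witness
`t` writes `z` as a combination of vertices with nonnegative coefficients of total at most `m`. -/
theorem mem_smul_convexHull_iff [Nonempty ι] {V : Set (ι → ℝ)}
    (hV : ∀ x, x ∈ V ↔ (∃ i, x = Pi.single i 1 ∨ x = Pi.single i (-1)) ∨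
      ∃ r, x = blockVector β σ r ∨ (two r ∧ x = -blockVector β σ r)) (m : ℕ) (z : ι → ℝ) :
    z ∈ (m : ℝ) • convexHull ℝ V ↔ InDilate β σ two m z := by
  have hK := convex_convexHull ℝ V
  constructor
  · rintro ⟨p, hp, rfl⟩
    have hconv : Convex ℝ {p : ι → ℝ | InDilate β σ two 1 p} := by
      intro p hp q hq a b ha hb hab
      have := (InDilate.smul ha hp).add (InDilate.smul hb hq)
      rwa [mul_one, mul_one, hab] at this
    have hsub : V ⊆ {p : ι → ℝ | InDilate β σ two 1 p} := by
      intro x hx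
      rcases (hV x).1 hx with ⟨i, rfl | rfl⟩ | ⟨r, rfl | ⟨h2, rfl⟩⟩
      · exact inDilate_single i (by simp)
      · exact inDilate_single i (by simp)
      · simpa using inDilate_blockVector (β := β) (σ := σ) (two := two) r (c := 1) (by simp)
          (by simp)
      · simpa using inDilate_blockVector (β := β) (σ := σ) (two := two) r (c := -1) (by simp)
          (fun h => absurd h2 h)
    have := InDilate.smul (Nat.cast_nonneg m) (convexHull_min hsub hconv hp)
    rwa [mul_one] at this
  · rintro ⟨t, ht, hle⟩
    have hpos (i : ι) : Pi.single i 1 ∈ convexHull ℝ V :=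
      subset_convexHull ℝ V ((hV _).2 (Or.inl ⟨i, Or.inl rfl⟩))
    have hneg (i : ι) : Pi.single i (-1) ∈ convexHull ℝ V :=
      subset_convexHull ℝ V ((hV _).2 (Or.inl ⟨i, Or.inr rfl⟩))
    have h0 : (0 : ι → ℝ) ∈ convexHull ℝ V := by
      obtain ⟨i⟩ := ‹Nonempty ι›
      have := hK (hpos i) (hneg i) (a := 1 / 2) (b := 1 / 2) (by norm_num) (by norm_num)
        (by norm_num)
      simpa [← smul_add, ← Pi.single_add] using this
    set c : ι → ℝ := fun i => z i - ∑ r, t r * blockVector β σ r i with hc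
    have hsum1 := sum_mem_smul_of_convex hK h0 (Finset.univ : Finset ι)
      (f := fun i => Pi.single i (c i)) (a := fun i => |c i|) (fun i => abs_nonneg _) fun i => by
        rcases le_total 0 (c i) with h | h
        · refine ⟨_, hpos i, ?_⟩
          simp [abs_of_nonneg h, ← Pi.single_smul]
        · refine ⟨_, hneg i, ?_⟩
          simp [abs_of_nonpos h, ← Pi.single_smul, ← Pi.single_neg]
    have hsum2 := sum_mem_smul_of_convex hK h0 (Finset.univ : Finset κ)
      (f := fun r => t r • blockVector β σ r) (a := fun r => |t r|) (fun r => abs_nonneg _)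
      fun r => by
        rcases le_or_gt 0 (t r) with h | h
        · refine ⟨_, subset_convexHull ℝ V ((hV _).2 (Or.inr ⟨r, Or.inl rfl⟩)), ?_⟩
          simp [abs_of_nonneg h]
        · have h2 : two r := by
            by_contra h2
            exact absurd (ht r h2) h.not_ge
          refine ⟨_, subset_convexHull ℝ V ((hV _).2 (Or.inr ⟨r, Or.inr ⟨h2, rfl⟩⟩)), ?_⟩
          simp [abs_of_neg h]
    have hz : z = ∑ i, Pi.single i (c i) + ∑ r, t r • blockVector β σ r := by
      rw [Finset.univ_sum_single]
      ext i
      simp [hc, Finset.sum_apply]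
    have hmem := Set.add_mem_add hsum1 hsum2
    rw [← hz, ← hK.add_smul (Finset.sum_nonneg fun i _ => abs_nonneg _)
      (Finset.sum_nonneg fun i _ => abs_nonneg _)] at hmem
    set A := ∑ i, |c i| + ∑ r, |t r|
    have hA : 0 ≤ A := add_nonneg (Finset.sum_nonneg fun i _ => abs_nonneg _)
      (Finset.sum_nonneg fun i _ => abs_nonneg _)
    -- The unused mass `m - A` is placed on the origin.
    have : (m : ℝ) = A + (m - A) := by ring
    rw [this, hK.add_smul hA (by linarith)]
    rw [← add_zero z]
    exact Set.add_mem_add hmem ⟨0, h0, smul_zero _⟩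

end ConvexHull

/-! ### Block decomposition from the middle layer of vertices -/

section Ehrhart

variable {ι : Type*} [Fintype ι] [DecidableEq ι]

/-- A finite set of nonzero vectors contains a set of representatives up to sign. -/
theorem exists_sign_representatives {E : Type*} [AddCommGroup E] [IsAddTorsionFree E] {W : Set E}
    (hW : W.Finite) (h0 : ∀ x ∈ W, x ≠ 0) :
    ∃ R : Finset E, (∀ x ∈ R, x ∈ W) ∧ (∀ x ∈ W, x ∈ R ∨ -x ∈ R) ∧ ∀ x ∈ R, -x ∉ R := by
  classical
  induction W, hW using Set.Finite.induction_on with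
  | empty => exact ⟨∅, by simp⟩
  | @insert a S ha hS ih =>
    obtain ⟨R, h1, h2, h3⟩ := ih fun x hx => h0 x (Set.mem_insert_of_mem _ hx)
    by_cases hneg : -a ∈ R
    · refine ⟨R, fun x hx => Set.mem_insert_of_mem _ (h1 x hx), ?_, h3⟩
      rintro x (rfl | hx)
      · exact Or.inr hneg
      · exact h2 x hx
    · refine ⟨insert a R, ?_, ?_, ?_⟩
      · intro x hx
        rcases Finset.mem_insert.1 hx with rfl | hx
        · exact Set.mem_insert _ _
        · exact Set.mem_insert_of_mem _ (h1 x hx)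
      · rintro x (rfl | hx)
        · exact Or.inl (Finset.mem_insert_self _ _)
        · exact (h2 x hx).imp (Finset.mem_insert_of_mem) (Finset.mem_insert_of_mem)
      · intro x hx hx'
        rcases Finset.mem_insert.1 hx with rfl | hx <;>
          rcases Finset.mem_insert.1 hx' with h | h
        · exact h0 x (Set.mem_insert _ _) (self_eq_neg.1 h.symm)
        · exact hneg h
        · exact hneg (by rw [← h, neg_neg]; exact hx)
        · exact h3 x hx h

theorem even_card_of_sum_signs {α : Type*} [Fintype α] {f : α → ℤ} (hf : ∀ a, f a = 1 ∨ f a = -1)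
    (h : ∑ a, f a = 0) : Even (Fintype.card α) := by
  have h1 : Even (∑ a, (f a + 1)) := Finset.even_sum _ fun a _ => by
    rcases hf a with h | h <;> rw [h] <;> decide
  rw [Finset.sum_add_distrib, h, zero_add, Finset.sum_const, Finset.card_univ, nsmul_eq_mul,
    mul_one] at h1
  exact_mod_cast h1

/-- One representative of each pair `± x` in the middle layer gives a block, with its support as
index set and its entries as signs. The block is two-sided when the opposite vector is a vertex as
well. -/
theorem FacetCoordinates.exists_gammaCone [Nonempty ι] {V : Set (ι → ℝ)} {L : AddSubgroup (ι → ℝ)}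
    (h : FacetCoordinates V L) : ∃ f : ℝ[X], GammaCone (Fintype.card ι) f ∧
      (PowerSeries.mk fun m : ℕ => ({z | z ∈ L ∧ z ∈ (m : ℝ) • convexHull ℝ V}.ncard : ℝ)) =
        f * geom ^ (Fintype.card ι + 1) := by
  classical
  obtain ⟨R, hRW, hWR, hRneg⟩ := exists_sign_representatives
    (W := {x ∈ V | ∑ i, x i = 0}) (h.finite.subset fun x hx => hx.1)
    fun x hx => h.ne_zero x hx.1
  have huniq {r r' : R} {i : ι} (hr : r.1 i ≠ 0) (hr' : r'.1 i ≠ 0) : r' = r := by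
    obtain ⟨h1, h2⟩ := hRW r r.2
    obtain ⟨h3, h4⟩ := hRW r' r'.2
    rcases h.eq_or_eq_neg_of_overlap h1 h3 h2 h4 hr hr' with h5 | h5
    · exact Subtype.ext h5
    · exact absurd (h5 ▸ r'.2) (hRneg r r.2)
  let β : ι → Option R := fun i =>
    if hi : ∃ r : R, r.1 i ≠ 0 then some hi.choose else none
  have hβ (i : ι) (r : R) : β i = some r ↔ r.1 i ≠ 0 := by
    simp only [β]
    split_ifs with hi
    · rw [Option.some_inj]
      exact ⟨fun he => he ▸ hi.choose_spec, fun hr => huniq hr hi.choose_spec⟩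
    · exact ⟨fun he => (nomatch he), fun hr => absurd ⟨r, hr⟩ hi⟩
  have hcoord (r : R) (i : ι) (hi : r.1 i ≠ 0) : r.1 i = 1 ∨ r.1 i = -1 :=
    (h.coord_int (hRW r r.2).1 (hRW r r.2).2 hi).1
  let σ : ι → ℤ := fun i => if ∃ r : R, r.1 i = -1 then -1 else 1
  have hσ (i : ι) : σ i = 1 ∨ σ i = -1 := by
    simp only [σ]; split_ifs <;> simp
  have hσr (r : R) (i : ι) (hi : r.1 i ≠ 0) : (σ i : ℝ) = r.1 i := by
    simp only [σ]
    split_ifs with hex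
    · obtain ⟨r', hr'⟩ := hex
      obtain rfl := huniq hi (r' := r') (by rw [hr']; norm_num)
      rw [hr']; norm_num
    · rcases hcoord r i hi with h1 | h1
      · rw [h1]; norm_num
      · exact absurd ⟨r, h1⟩ hex
  have hbv (r : R) : blockVector β σ r = r.1 := by
    funext i
    simp only [blockVector, hβ]
    split_ifs with hi
    · exact hσr r i hi
    · exact (not_not.1 hi).symm
  let two : R → Prop := fun r => -r.1 ∈ V
  -- The entries of `r` on its support are signs with sum zero, so the support has even size.
  have hk (r : R) : Fintype.card {i // β i = some r} =
      2 * (Fintype.card {i // β i = some r} / 2) := by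
    refine (Nat.two_mul_div_two_of_even ?_).symm
    refine even_card_of_sum_signs (f := fun i => σ i.1) (fun i => hσ i) ?_
    have h0 := (hRW r r.2).2
    rw [sum_blocks β, Finset.sum_eq_zero, zero_add, Finset.sum_eq_single r] at h0
    · rw [← Int.cast_inj (α := ℝ), Int.cast_sum, Int.cast_zero, ← h0]
      exact Finset.sum_congr rfl fun i _ => hσr r i ((hβ i r).1 i.2)
    · intro r' _ hr'
      refine Finset.sum_eq_zero fun i _ => ?_
      by_contra hi
      exact hr' (huniq hi ((hβ i r').1 i.2))
    · simp
    · intro i _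
      by_contra hi
      have := (hβ i r).2 hi
      rw [i.2] at this
      cases this
  have hV (x : ι → ℝ) : x ∈ V ↔ (∃ i, x = Pi.single i 1 ∨ x = Pi.single i (-1)) ∨
      ∃ r, x = blockVector β σ r ∨ (two r ∧ x = -blockVector β σ r) := by
    simp only [hbv]
    constructor
    · intro hx
      obtain ⟨n, hn⟩ := h.sum_int x (h.subset x hx)
      have hn1 := h.le_one x hx
      have hn2 := h.neg_one_le x hx
      rw [hn] at hn1 hn2
      have hn1' : n ≤ 1 := by exact_mod_cast hn1
      have hn2' : -1 ≤ n := by exact_mod_cast hn2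
      rcases (by omega : n = -1 ∨ n = 0 ∨ n = 1) with rfl | rfl | rfl
      · obtain ⟨j, hj⟩ := h.eq_neg x hx (by rw [hn]; norm_num)
        exact Or.inl ⟨j, Or.inr hj⟩
      · right
        rcases hWR x ⟨hx, by rw [hn]; norm_num⟩ with hR | hR
        · exact ⟨⟨x, hR⟩, Or.inl rfl⟩
        · exact ⟨⟨-x, hR⟩, Or.inr ⟨by simpa [two] using hx, by simp⟩⟩
      · obtain ⟨j, hj⟩ := h.eq_pos x hx (by rw [hn]; norm_num)
        exact Or.inl ⟨j, Or.inl hj⟩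
    · rintro (⟨i, rfl | rfl⟩ | ⟨r, rfl | ⟨h2, rfl⟩⟩)
      · exact h.pos i
      · exact h.neg i
      · exact (hRW r r.2).1
      · exact h2
  obtain ⟨f, hf, hfe⟩ := exists_gammaCone_of_blocks (two := two) hσ hk
    (fun i => h.subset _ (h.pos i)) h.sum_int (fun z hz i => h.two_mul_int hz i)
    (fun z hz i hi => by
      obtain ⟨r, hr⟩ := Option.ne_none_iff_exists'.1 hi
      exact (h.coord_int (hRW r r.2).1 (hRW r r.2).2 ((hβ i r).1 hr)).2 z hz)
  refine ⟨f, hf, ?_⟩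
  rw [← hfe]
  congr 1
  funext m
  simp only [mem_smul_convexHull_iff hV]

end Ehrhart

/-! ### Facets, their functionals, simpliciality and integrality -/

section Facets

variable {d : ℕ} {P : Set (Fin d → ℝ)}

/-- The set lies on an affine hyperplane missing the origin, so its linear span is its direction
space plus the line through one of its points. -/
theorem finrank_vectorSpan_add_one {E : Type*} [AddCommGroup E] [Module ℝ E]
    [FiniteDimensional ℝ E] {G : Set E} (hG : G.Nonempty) (l : E →ₗ[ℝ] ℝ) (hl : ∀ x ∈ G, l x = 1) :
    Module.finrank ℝ (vectorSpan ℝ G) + 1 = Module.finrank ℝ (Submodule.span ℝ G) := by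
  obtain ⟨x₀, hx₀⟩ := hG
  have hker : vectorSpan ℝ G ≤ LinearMap.ker l := by
    rw [vectorSpan_def, Submodule.span_le]
    rintro _ ⟨x, hx, y, hy, rfl⟩
    simp [hl x hx, hl y hy]
  have hinf : vectorSpan ℝ G ⊓ Submodule.span ℝ {x₀} = ⊥ := by
    rw [eq_bot_iff]
    rintro y ⟨hy1, hy2⟩
    obtain ⟨c, rfl⟩ := Submodule.mem_span_singleton.1 hy2
    have : l (c • x₀) = 0 := hker hy1
    rw [map_smul, hl x₀ hx₀, smul_eq_mul, mul_one] at this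
    simp [this]
  have hsup : vectorSpan ℝ G ⊔ Submodule.span ℝ {x₀} = Submodule.span ℝ G := by
    refine le_antisymm (sup_le ?_ ?_) (Submodule.span_le.2 fun x hx => ?_)
    · rw [vectorSpan_def, Submodule.span_le]
      rintro _ ⟨x, hx, y, hy, rfl⟩
      exact Submodule.sub_mem _ (Submodule.subset_span hx) (Submodule.subset_span hy)
    · exact Submodule.span_mono (Set.singleton_subset_iff.2 hx₀)
    · have := Submodule.add_mem_sup (vsub_mem_vectorSpan ℝ hx hx₀)
        (Submodule.mem_span_singleton_self (R := ℝ) x₀)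
      simpa using this
  have hne : x₀ ≠ 0 := fun h => by
    have := hl x₀ hx₀
    rw [h, map_zero] at this
    exact zero_ne_one this
  have := Submodule.finrank_sup_add_finrank_inf_eq (vectorSpan ℝ G) (Submodule.span ℝ {x₀})
  rw [hinf, hsup, finrank_bot, finrank_span_singleton hne] at this
  omega

theorem linearIndepOn_of_affineIndependent {E : Type*} [AddCommGroup E] [Module ℝ E]
    [FiniteDimensional ℝ E] {S : Finset E} (hS : AffineIndependent ℝ (fun v : S => (v : E)))
    (l : E →ₗ[ℝ] ℝ) (hl : ∀ x ∈ S, l x = 1) : LinearIndepOn ℝ id (S : Set E) := by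
  rcases S.eq_empty_or_nonempty with rfl | hne
  · simp
  · have : Nonempty S := hne.coe_sort
    have h1 := hS.finrank_vectorSpan_add_one
    rw [Subtype.range_coe_subtype] at h1
    have h2 := finrank_vectorSpan_add_one (G := {x | x ∈ S}) hne l hl
    refine linearIndependent_iff_card_eq_finrank_span.2 ?_
    have hr : (Set.range fun x : (S : Set E) => id x.1) = {x | x ∈ S} := by ext; simp
    rw [Set.finrank, hr, ← h2, h1]
    exact Fintype.card_congr (Equiv.refl _)

theorem isExposed_eq_one (l : (Fin d → ℝ) →ₗ[ℝ] ℝ) (hl : ∀ x ∈ P, l x ≤ 1) :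
    IsExposed ℝ P {x ∈ P | l x = 1} := by
  rintro ⟨x₀, hx₀, h₀⟩
  refine ⟨LinearMap.toContinuousLinearMap l, ?_⟩
  ext x
  simp only [Set.mem_ofPred_eq, LinearMap.coe_toContinuousLinearMap']
  refine and_congr_right fun hx => ⟨fun h y hy => h ▸ hl y hy, fun h => ?_⟩
  exact le_antisymm (hl x hx) (h₀ ▸ h x₀ hx₀)

theorem dim_of_nonempty {A : Set (Fin d → ℝ)} (h : A.Nonempty) :
    dim A = Module.finrank ℝ (vectorSpan ℝ A) := by
  rw [dim, if_neg h.ne_empty]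

/-- Spanning gives the face dimension `d - 1`, so it is a facet and hence a simplex. Extreme points
of `P` on it are among the vertices of that simplex, which are independent because `l = 1` there. -/
theorem linearIndepOn_extremePoints_eq_one (hdim : dim P = d) (hsimp : IsSimplicial P)
    {l : (Fin d → ℝ) →ₗ[ℝ] ℝ} (hl : ∀ x ∈ P, l x ≤ 1)
    (hspan : Submodule.span ℝ {x ∈ P.extremePoints ℝ | l x = 1} = ⊤) :
    LinearIndepOn ℝ id {x ∈ P.extremePoints ℝ | l x = 1} := by
  rcases Set.eq_empty_or_nonempty {x ∈ P.extremePoints ℝ | l x = 1} with he | hne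
  · rw [he]; exact linearIndepOn_empty ℝ id
  have hsub : {x ∈ P.extremePoints ℝ | l x = 1} ⊆ {x ∈ P | l x = 1} :=
    fun x hx => ⟨extremePoints_subset hx.1, hx.2⟩
  have hspan' : Submodule.span ℝ {x ∈ P | l x = 1} = ⊤ :=
    top_le_iff.1 (hspan ▸ Submodule.span_mono hsub)
  have hfacet : IsFacet P {x ∈ P | l x = 1} := by
    refine ⟨isExposed_eq_one l hl, ?_⟩
    have := finrank_vectorSpan_add_one (hne.mono hsub) l fun x hx => hx.2
    rw [hspan', finrank_top, Module.finrank_fin_fun] at this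
    rw [dim_of_nonempty (hne.mono hsub), hdim]
    omega
  obtain ⟨T, hT, hGT⟩ := hsimp _ hfacet
  have hlin := linearIndepOn_of_affineIndependent hT l fun x hx => by
    have : x ∈ {x ∈ P | l x = 1} := hGT ▸ subset_convexHull ℝ _ hx
    exact this.2
  refine hlin.mono fun x hx => ?_
  have h1 := inter_extremePoints_subset_extremePoints_of_subset (𝕜 := ℝ)
    (B := {x ∈ P | l x = 1}) (fun x hx => hx.1) ⟨hsub hx, hx.1⟩
  rw [hGT] at h1
  exact extremePoints_convexHull_subset h1

theorem subset_of_span_eq_top {E : Type*} [AddCommGroup E] [Module ℝ E] {A B : Set E}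
    (hA : LinearIndepOn ℝ id A) (hBA : B ⊆ A) (hB : Submodule.span ℝ B = ⊤) : A ⊆ B := by
  intro x hx
  by_contra hxB
  have := LinearIndependent.notMem_span_image hA (s := {a | a.1 ∈ B}) (x := ⟨x, hx⟩) hxB
  apply this
  have himg : (fun a : A => id a.1) '' {a | a.1 ∈ B} = B := by
    ext y
    simp only [Set.mem_image, id]
    exact ⟨by rintro ⟨a, ha, rfl⟩; exact ha, fun hy => ⟨⟨y, hBA hy⟩, hy, rfl⟩⟩
  rw [himg, hB]
  trivial

theorem exists_dotProduct (l : (Fin d → ℝ) →ₗ[ℝ] ℝ) : ∃ g : Fin d → ℝ, ∀ x, l x = x ⬝ᵥ g :=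
  ⟨fun i => l fun j => if i = j then 1 else 0, fun x => by
    rw [l.pi_apply_eq_sum_univ x]; simp [dotProduct]⟩

/-- Inequalities tight on a spanning set determine `l`, so its vector is an extreme point of the
dual polytope and therefore a lattice point. -/
theorem exists_int_of_span_eq_top (hdual : IsLatticePolytope (dualPolytope P))
    {l : (Fin d → ℝ) →ₗ[ℝ] ℝ} (hl : ∀ x ∈ P, l x ≤ 1)
    (hspan : Submodule.span ℝ {x ∈ P.extremePoints ℝ | l x = 1} = ⊤) (z : Fin d → ℤ) :
    ∃ n : ℤ, l (latticePoint z) = n := by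
  obtain ⟨g, hg⟩ := exists_dotProduct l
  have hgQ : g ∈ (dualPolytope P).extremePoints ℝ := by
    rw [mem_extremePoints_iff_left]
    refine ⟨fun x hx => hg x ▸ hl x hx, fun y₁ h₁ y₂ h₂ ⟨a, b, ha, hb, hab, hy⟩ => ?_⟩
    have hz (x) (hx : x ∈ {x ∈ P.extremePoints ℝ | l x = 1}) : x ⬝ᵥ (y₁ - g) = 0 := by
      have e1 := h₁ x (extremePoints_subset hx.1)
      have e2 := h₂ x (extremePoints_subset hx.1)
      have e3 := hx.2
      rw [hg x] at e3
      have e4 := e3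
      rw [← hy, dotProduct_add, dotProduct_smul, dotProduct_smul, smul_eq_mul, smul_eq_mul] at e4
      rw [dotProduct_sub, e3]
      nlinarith
    have hall (x : Fin d → ℝ) : x ⬝ᵥ (y₁ - g) = 0 := by
      have hx : x ∈ Submodule.span ℝ {x ∈ P.extremePoints ℝ | l x = 1} := hspan ▸ trivial
      induction hx using Submodule.span_induction with
      | mem x hx => exact hz x hx
      | zero => exact zero_dotProduct _
      | add x y _ _ h1 h2 => rw [add_dotProduct, h1, h2, add_zero]
      | smul c x _ h => rw [smul_dotProduct, h, smul_zero]
    exact sub_eq_zero.1 (dotProduct_self_eq_zero.1 (hall _))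
  obtain ⟨S, -, hS⟩ := hdual
  rw [hS] at hgQ
  obtain ⟨n, -, rfl⟩ := extremePoints_convexHull_subset hgQ
  exact ⟨z ⬝ᵥ n, by rw [hg]; simp [dotProduct, latticePoint]⟩

theorem extremePoints_subset_latticePoint (hP : IsLatticePolytope P) :
    (P.extremePoints ℝ).Finite ∧ P.extremePoints ℝ ⊆ Set.range latticePoint ∧
      convexHull ℝ (P.extremePoints ℝ) = P := by
  obtain ⟨S, -, rfl⟩ := hP
  have hfin : (latticePoint '' (S : Set (Fin d → ℤ))).Finite := S.finite_toSet.image _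
  have hsub := extremePoints_convexHull_subset (𝕜 := ℝ)
    (A := latticePoint '' (S : Set (Fin d → ℤ)))
  refine ⟨hfin.subset hsub, hsub.trans (Set.image_subset_range _ _), ?_⟩
  have h := closure_convexHull_extremePoints (hfin.isCompact_convexHull ℝ) (convex_convexHull ℝ _)
  rwa [((hfin.subset hsub).isClosed_convexHull ℝ).closure_eq] at h

theorem isCompact_of_isLatticePolytope (hP : IsLatticePolytope P) : IsCompact P := by
  obtain ⟨S, -, rfl⟩ := hP
  exact (S.finite_toSet.image _).isCompact_convexHull ℝ

/-- A supporting functional is positive on the facet because the origin is interior, so it can be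
scaled to `1`. The vertices of the facet span because the facet is the closed convex hull of its
extreme points and has dimension `d - 1`. -/
theorem exists_functional_of_isFacet [NeZero d] (hP : IsLatticePolytope P) (hdim : dim P = d)
    (h0 : (0 : Fin d → ℝ) ∈ interior P) {F : Set (Fin d → ℝ)} (hF : IsFacet P F) :
    ∃ l : (Fin d → ℝ) →ₗ[ℝ] ℝ, (∀ x ∈ P, l x ≤ 1) ∧ F = {x ∈ P | l x = 1} ∧
      Submodule.span ℝ {x ∈ P.extremePoints ℝ | l x = 1} = ⊤ := by
  obtain ⟨hexp, hFdim⟩ := hF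
  rw [hdim] at hFdim
  have hd : 0 < d := Nat.pos_of_neZero d
  have hFne : F.Nonempty := by
    by_contra h
    rw [Set.not_nonempty_iff_eq_empty] at h
    rw [dim, if_pos h] at hFdim
    omega
  obtain ⟨f, hf⟩ := hexp hFne
  obtain ⟨x₀, hx₀⟩ := hFne
  have hx₀' := hx₀
  rw [hf] at hx₀'
  have h0P : (0 : Fin d → ℝ) ∈ P := interior_subset h0
  have hM : 0 < f x₀ := by
    have h1 := hx₀'.2 0 h0P
    rw [map_zero] at h1
    rcases h1.lt_or_eq with h | h
    · exact h
    -- A functional with maximum `0` around the origin vanishes identically; then `F = P`, which has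
    -- the wrong dimension.
    · exfalso
      have hle (y : Fin d → ℝ) : f y ≤ 0 := by
        have ht : Filter.Tendsto (fun t : ℝ => t • y) (nhds 0) (nhds 0) := by
          have : Continuous fun t : ℝ => t • y := by fun_prop
          simpa using this.tendsto 0
        have h2 : ∀ᶠ t : ℝ in nhdsWithin 0 (Set.Ioi 0), t • y ∈ P :=
          (ht.mono_left nhdsWithin_le_nhds) (mem_interior_iff_mem_nhds.1 h0)
        obtain ⟨t, htP, ht0⟩ := (h2.and self_mem_nhdsWithin).exists
        have h3 := hx₀'.2 _ htP
        rw [← h, map_smul, smul_eq_mul] at h3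
        exact nonpos_of_mul_nonpos_right h3 ht0
      have hz (y : Fin d → ℝ) : f y = 0 :=
        le_antisymm (hle y) (by have := hle (-y); rw [map_neg] at this; linarith)
      have hFP : F = P := by
        rw [hf]; ext x; simp [hz]
      rw [hFP, hdim] at hFdim
      omega
  let l : (Fin d → ℝ) →ₗ[ℝ] ℝ := (f x₀)⁻¹ • (f : (Fin d → ℝ) →ₗ[ℝ] ℝ)
  have hl (x) : l x = (f x₀)⁻¹ * f x := rfl
  have hle (x) (hx : x ∈ P) : l x ≤ 1 := by
    rw [hl, inv_mul_le_one₀ hM]; exact hx₀'.2 x hx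
  have hFl : F = {x ∈ P | l x = 1} := by
    rw [hf]
    ext x
    simp only [Set.mem_ofPred_eq]
    refine and_congr_right fun hx => ?_
    rw [hl, inv_mul_eq_one₀ hM.ne']
    exact ⟨fun h => le_antisymm (h x₀ hx₀'.1) (hx₀'.2 x hx), fun h y hy => h ▸ hx₀'.2 y hy⟩
  refine ⟨l, hle, hFl, ?_⟩
  have hspanF : Submodule.span ℝ F = ⊤ := by
    have h1 := finrank_vectorSpan_add_one ⟨x₀, hx₀⟩ l fun x hx => (hFl ▸ hx : x ∈ {x ∈ P | l x = 1}).2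
    rw [dim_of_nonempty ⟨x₀, hx₀⟩] at hFdim
    refine Submodule.eq_top_of_finrank_eq ?_
    rw [Module.finrank_fin_fun]
    omega
  have hexp' := isExposed_eq_one l hle
  rw [← hFl] at hexp'
  have hext : F.extremePoints ℝ ⊆ {x ∈ P.extremePoints ℝ | l x = 1} := fun x hx =>
    ⟨hexp'.isExtreme.extremePoints_subset_extremePoints hx,
      (hFl ▸ extremePoints_subset hx : x ∈ {x ∈ P | l x = 1}).2⟩
  have hFc : IsCompact F := by
    have hlc : Continuous l := LinearMap.continuous_of_finiteDimensional l
    rw [hFl]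
    exact (isCompact_of_isLatticePolytope hP).inter_right (isClosed_eq hlc continuous_const)
  have hFconv : Convex ℝ F := by
    obtain ⟨S, -, rfl⟩ := hP
    exact hexp'.convex (convex_convexHull ℝ _)
  rw [← top_le_iff, ← hspanF, Submodule.span_le, ← closure_convexHull_extremePoints hFc hFconv]
  refine closure_minimal ?_ (Submodule.closed_of_finiteDimensional _)
  refine convexHull_min (hext.trans Submodule.subset_span) (Submodule.convex _)

end Facets

/-! ### Passage to facet coordinates and to an integer polynomial -/

section Main

/-- The embedding of `ℤ^d` into `ℝ^d` as a homomorphism. -/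
def latticeHom (d : ℕ) : (Fin d → ℤ) →+ (Fin d → ℝ) where
  toFun := latticePoint
  map_zero' := by ext; simp [latticePoint]
  map_add' _ _ := by ext; simp [latticePoint]

theorem latticePoint_injective {d : ℕ} : Function.Injective (latticePoint (d := d)) :=
  fun _ _ h => funext fun i => Int.cast_injective (congrFun h i)

theorem span_insert_singles {ι : Type*} [Fintype ι] [DecidableEq ι] {g w : ι → ℝ} {i : ι}
    (hg : ∀ j, j ≠ i → g j = 1 ∨ g j = -1) (hw : w i ≠ 0) :
    Submodule.span ℝ (insert w {x | ∃ j, j ≠ i ∧ x = Pi.single j (g j)}) = ⊤ := by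
  set S := Submodule.span ℝ (insert w {x | ∃ j, j ≠ i ∧ x = Pi.single j (g j)})
  have hj (j : ι) (hj : j ≠ i) (c : ℝ) : Pi.single j c ∈ S := by
    have h1 : Pi.single j (g j) ∈ S :=
      Submodule.subset_span (Set.mem_insert_of_mem _ ⟨j, hj, rfl⟩)
    have h2 := S.smul_mem (c * g j) h1
    rw [← Pi.single_smul, smul_eq_mul, mul_assoc] at h2
    have : g j * g j = 1 := by rcases hg j hj with h | h <;> simp [h]
    rwa [this, mul_one] at h2
  have hi (c : ℝ) : Pi.single i c ∈ S := by
    have h1 : w ∈ S := Submodule.subset_span (Set.mem_insert _ _)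
    have h2 : w - ∑ j ∈ Finset.univ.erase i, Pi.single j (w j) = Pi.single i (w i) := by
      conv_lhs => enter [1]; rw [← Finset.univ_sum_single w]
      rw [← Finset.add_sum_erase _ _ (Finset.mem_univ i), add_sub_cancel_right]
    have h3 : Pi.single i (w i) ∈ S :=
      h2 ▸ S.sub_mem h1 (S.sum_mem fun j hj' => hj j (Finset.ne_of_mem_erase hj') _)
    have h4 := S.smul_mem (c * (w i)⁻¹) h3
    rwa [← Pi.single_smul, smul_eq_mul, mul_assoc, inv_mul_cancel₀ hw, mul_one] at h4
  refine eq_top_iff.2 fun x _ => ?_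
  rw [← Finset.univ_sum_single x]
  refine S.sum_mem fun j _ => ?_
  rcases eq_or_ne j i with rfl | h
  · exact hi _
  · exact hj j h _

/-- The basis is the vertex set of `F`, independent by simpliciality. Integrality of facet
functionals comes from reflexivity. -/
theorem exists_facetCoordinates {d : ℕ} [NeZero d] {P : Set (Fin d → ℝ)} (hP : IsReflexive P)
    (hsimp : IsSimplicial P) (hps : IsPseudoSymmetric P) :
    ∃ (ι : Type) (_ : Fintype ι) (_ : DecidableEq ι) (b : Module.Basis ι ℝ (Fin d → ℝ)),
      Fintype.card ι = d ∧ FacetCoordinates (b.equivFun '' P.extremePoints ℝ)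
        ((latticeHom d).range.comap (b.equivFun.symm : (ι → ℝ) →+ (Fin d → ℝ))) := by
  classical
  obtain ⟨hlat, hdim, hint, hdual⟩ := hP
  obtain ⟨hfin, hsub, hconv⟩ := extremePoints_subset_latticePoint hlat
  have h0 : (0 : Fin d → ℝ) ∈ interior P := by
    have := (hint 0).2 rfl
    convert this using 1
    ext i
    simp [latticePoint]
  obtain ⟨F, hF, hnF⟩ := hps
  obtain ⟨u, hu, hFu, hspan⟩ := exists_functional_of_isFacet hlat hdim h0 hF
  obtain ⟨u', hu', hFu', hspan'⟩ := exists_functional_of_isFacet hlat hdim h0 hnF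
  have hlin := linearIndepOn_extremePoints_eq_one hdim hsimp hu hspan
  -- Both functionals are `-1` on the vertices of `F`, which span.
  have huu : u' = -u := by
    refine LinearMap.ext_on_range (v := fun x : {x ∈ P.extremePoints ℝ | u x = 1} => x.1) ?_ ?_
    · rw [Subtype.range_coe]; exact hspan
    · rintro ⟨x, hx, hx1⟩
      have hxF : x ∈ F := by rw [hFu]; exact ⟨extremePoints_subset hx, hx1⟩
      have hx' : -x ∈ -F := by simpa using hxF
      rw [hFu'] at hx'
      have := hx'.2
      rw [map_neg] at this
      simp only [LinearMap.neg_apply, hx1]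
      linarith
  subst huu
  have hextF : F.extremePoints ℝ = {x ∈ P.extremePoints ℝ | u x = 1} := by
    have hext := (isExposed_eq_one u hu).isExtreme (𝕜 := ℝ)
    rw [← hFu] at hext
    rw [hext.extremePoints_eq, hFu]
    ext x
    exact ⟨fun h => ⟨h.2, h.1.2⟩, fun h => ⟨⟨extremePoints_subset h.1, h.2⟩, h.1⟩⟩
  have hextnF : (-F).extremePoints ℝ = {x ∈ P.extremePoints ℝ | u x = -1} := by
    have hext := (isExposed_eq_one (-u) hu').isExtreme (𝕜 := ℝ)
    rw [← hFu'] at hext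
    rw [hext.extremePoints_eq, hFu']
    ext x
    have : (-u) x = 1 ↔ u x = -1 := by rw [LinearMap.neg_apply, neg_eq_iff_eq_neg]
    exact ⟨fun h => ⟨h.2, this.1 h.1.2⟩,
      fun h => ⟨⟨extremePoints_subset h.1, this.2 h.2⟩, h.1⟩⟩
  have hneg (x : Fin d → ℝ) : x ∈ P.extremePoints ℝ ∧ u x = -1 ↔
      -x ∈ P.extremePoints ℝ ∧ u (-x) = 1 := by
    have h1 := image_extremePoints (LinearEquiv.neg ℝ (M := Fin d → ℝ)) F
    have h2 : (LinearEquiv.neg ℝ (M := Fin d → ℝ)) '' F = -F := by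
      ext x; simp
    rw [h2, hextF, hextnF] at h1
    have h3 := Set.ext_iff.1 h1 x
    constructor
    · intro h
      obtain ⟨y, hy, rfl⟩ := h3.2 h
      simpa using hy
    · intro h
      exact h3.1 ⟨-x, h, by simp⟩
  set A := {x ∈ P.extremePoints ℝ | u x = 1} with hA
  have : Fintype A := (hfin.subset fun x hx => hx.1).fintype
  have hrange : (Set.range fun x : A => id x.1) = A := by simp
  let b : Module.Basis A ℝ (Fin d → ℝ) := Module.Basis.mk hlin (by rw [hrange, hspan])
  have hb (a : A) : b a = a.1 := by simp [b]
  have hcard : Fintype.card A = d := by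
    rw [← Module.finrank_eq_card_basis b, Module.finrank_fin_fun]
  have hsum (x : Fin d → ℝ) : ∑ a, b.equivFun x a = u x := by
    conv_rhs => rw [← b.sum_equivFun x]
    rw [map_sum]
    refine Finset.sum_congr rfl fun a _ => ?_
    rw [map_smul, hb, a.2.2, smul_eq_mul, mul_one]
  have hsingle (a : A) (c : ℝ) : b.equivFun.symm (Pi.single a c) = c • a.1 := by
    rw [← hb, Module.Basis.equivFun_symm_apply, Finset.sum_eq_single a]
    · simp
    · intro j _ hj; simp [hj]
    · simp
  have hsingle' (a : A) (c : ℝ) : b.equivFun (c • a.1) = Pi.single a c := by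
    rw [← hsingle, LinearEquiv.apply_symm_apply]
  have hnegA (a : A) : -a.1 ∈ P.extremePoints ℝ := ((hneg (-a.1)).2 (by rw [neg_neg]; exact a.2)).1
  have hne : Nonempty A := by
    rw [← Fintype.card_pos_iff, hcard]; exact Nat.pos_of_neZero d
  refine ⟨A, inferInstance, inferInstance, b, hcard, ?_⟩
  refine
    { finite := hfin.image _
      subset := ?_
      pos := fun a => ⟨a.1, a.2.1, by rw [← hsingle', one_smul]⟩
      neg := fun a => ⟨-a.1, hnegA a, by rw [← hsingle', neg_one_smul]⟩
      sum_int := ?_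
      le_one := ?_
      neg_one_le := ?_
      eq_pos := ?_
      eq_neg := ?_
      ne_zero := ?_
      facet := ?_ }
  · rintro _ ⟨x, hx, rfl⟩
    obtain ⟨z, rfl⟩ := hsub hx
    exact ⟨z, by simp [latticeHom]⟩
  · rintro z ⟨y, hy⟩
    obtain ⟨n, hn⟩ := exists_int_of_span_eq_top hdual hu hspan y
    refine ⟨n, ?_⟩
    have h1 : latticePoint y = b.equivFun.symm z := hy
    rw [← hn, ← hsum, h1, LinearEquiv.apply_symm_apply]
  · rintro _ ⟨x, hx, rfl⟩
    rw [hsum]; exact hu x (extremePoints_subset hx)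
  · rintro _ ⟨x, hx, rfl⟩
    rw [hsum]
    have := hu' x (extremePoints_subset hx)
    rw [LinearMap.neg_apply] at this
    linarith
  · rintro _ ⟨x, hx, rfl⟩ h1
    rw [hsum] at h1
    exact ⟨⟨x, hx, h1⟩, by rw [← hsingle', one_smul]⟩
  · rintro _ ⟨x, hx, rfl⟩ h1
    rw [hsum] at h1
    exact ⟨⟨-x, (hneg x).1 ⟨hx, h1⟩⟩, by rw [← hsingle', neg_one_smul, neg_neg]⟩
  · rintro _ ⟨x, hx, rfl⟩ h1
    have hx0 : x = 0 := by simpa using h1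
    obtain ⟨a⟩ := hne
    have h2 := (mem_extremePoints_iff_left.1 hx).2 a.1 (extremePoints_subset a.2.1) (-a.1)
      (extremePoints_subset (hnegA a))
      ⟨1 / 2, 1 / 2, by norm_num, by norm_num, by norm_num, by simp [hx0]⟩
    have h3 := a.2.2
    rw [h2, hx0, map_zero] at h3
    exact zero_ne_one h3
  · rintro g i w hg ⟨w, hw, rfl⟩ hwi hgw hle
    let l : (Fin d → ℝ) →ₗ[ℝ] ℝ :=
      { toFun := fun x => g ⬝ᵥ b.equivFun x
        map_add' := fun x y => by rw [map_add, dotProduct_add]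
        map_smul' := fun c x => by rw [map_smul, dotProduct_smul, RingHom.id_apply] }
    have hl (x) : l x = g ⬝ᵥ b.equivFun x := rfl
    have hlP (x) (hx : x ∈ P) : l x ≤ 1 := by
      rw [← hconv] at hx
      exact convexHull_min (t := {x | l x ≤ 1}) (fun x hx => hle _ ⟨x, hx, rfl⟩)
        (convex_halfSpace_le l.isLinear 1) hx
    -- These vectors are vertices on `l = 1` and span. Hence the face is a facet, and independence
    -- of its vertices leaves room for no others.
    have hB := span_insert_singles hg hwi
    set B' := insert (b.equivFun w) {x | ∃ j, j ≠ i ∧ x = Pi.single j (g j)} with hB'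
    have hBspan : Submodule.span ℝ (b.equivFun.symm '' B') = ⊤ := by
      have := Submodule.span_image (s := B') (b.equivFun.symm : (A → ℝ) →ₗ[ℝ] (Fin d → ℝ))
      rw [hB, Submodule.map_top, LinearEquiv.range] at this
      exact this
    have hBsub : b.equivFun.symm '' B' ⊆ {x ∈ P.extremePoints ℝ | l x = 1} := by
      rintro _ ⟨y, hy | ⟨j, hj, rfl⟩, rfl⟩
      · rw [hy, LinearEquiv.symm_apply_apply]
        exact ⟨hw, hgw⟩
      · refine ⟨?_, ?_⟩
        · rw [hsingle]
          rcases hg j hj with h | h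
          · rw [h, one_smul]; exact j.2.1
          · rw [h, neg_one_smul]; exact hnegA j
        · rw [hl, LinearEquiv.apply_symm_apply, dotProduct_single]
          rcases hg j hj with h | h <;> simp [h]
    have hEspan : Submodule.span ℝ {x ∈ P.extremePoints ℝ | l x = 1} = ⊤ :=
      top_le_iff.1 (hBspan ▸ Submodule.span_mono hBsub)
    refine ⟨?_, ?_⟩
    · rintro _ ⟨x, hx, rfl⟩ hgx
      have h1 := subset_of_span_eq_top
        (linearIndepOn_extremePoints_eq_one hdim hsimp hlP hEspan) hBsub hBspan
      obtain ⟨y, hy, hyx⟩ := h1 ⟨hx, hgx⟩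
      rw [← hyx, LinearEquiv.apply_symm_apply]
      exact hy
    · rintro z ⟨y, hy⟩
      obtain ⟨n, hn⟩ := exists_int_of_span_eq_top hdual hlP hEspan y
      refine ⟨n, ?_⟩
      have h1 : latticePoint y = b.equivFun.symm z := hy
      rw [← hn, h1, hl, LinearEquiv.apply_symm_apply]

/-- The integer series `H` becomes `f` over the reals, so its coefficients vanish beyond the degree
of `f` and `H` is a polynomial. Its constant term is `1`, as needed to fix the degree. -/
theorem exists_hStarPolynomial {d : ℕ} {P : Set (Fin d → ℝ)} (hP : P.Nonempty) {f : ℝ[X]}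
    (hf : GammaCone d f)
    (h : (PowerSeries.mk fun m : ℕ => (latticeCount P m : ℝ)) = f * geom ^ (d + 1)) :
    ∃ h : ℤ[X], IsHStarPolynomial P h ∧ IsGammaPositive (h.map (Int.castRingHom ℝ)) := by
  have hcount : latticeCount P 0 = 1 := by
    rw [latticeCount, Nat.cast_zero, Set.zero_smul_set hP]
    have : {z : Fin d → ℤ | latticePoint z ∈ (0 : Set (Fin d → ℝ))} = {0} := by
      ext z
      rw [Set.mem_ofPred_eq, Set.mem_zero, Set.mem_singleton_iff]
      exact map_eq_zero_iff (latticeHom d) latticePoint_injective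
    rw [this, Set.ncard_singleton]
  set H : ℤ⟦X⟧ := ehrhartSeries P * (1 - PowerSeries.X) ^ (d + 1) with hH
  have hmap : PowerSeries.map (Int.castRingHom ℝ) H = (f : ℝ⟦X⟧) := by
    have he : PowerSeries.map (Int.castRingHom ℝ) (ehrhartSeries P) = f * geom ^ (d + 1) := by
      rw [← h]
      ext m
      rw [PowerSeries.coeff_map, ehrhartSeries, PowerSeries.coeff_mk, PowerSeries.coeff_mk]
      split_ifs with hm
      · rw [hm, hcount]; simp
      · simp
    rw [hH, map_mul, he, map_pow, map_sub, map_one, PowerSeries.map_X, mul_assoc, geom_pow_mul,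
      mul_one]
  have hcoe : ((PowerSeries.trunc (f.natDegree + 1) H : ℤ[X]) : ℤ⟦X⟧) = H := by
    ext m
    rw [Polynomial.coeff_coe, PowerSeries.coeff_trunc]
    split_ifs with hm
    · rfl
    · have := congrArg (PowerSeries.coeff m) hmap
      rw [PowerSeries.coeff_map, Polynomial.coeff_coe,
        Polynomial.coeff_eq_zero_of_natDegree_lt (by omega)] at this
      exact (Int.cast_eq_zero.1 this).symm
  refine ⟨PowerSeries.trunc (f.natDegree + 1) H, hcoe.symm, ?_⟩
  have hfm : (PowerSeries.trunc (f.natDegree + 1) H).map (Int.castRingHom ℝ) = f := by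
    rw [← Polynomial.coe_inj, Polynomial.polynomial_map_coe, hcoe, hmap]
  rw [hfm]
  refine hf.isGammaPositive ?_
  have := congrArg (PowerSeries.coeff 0) hmap
  rw [Polynomial.coeff_coe] at this
  rw [← this, PowerSeries.coeff_map, hH, PowerSeries.coeff_zero_eq_constantCoeff_apply, map_mul,
    ← PowerSeries.coeff_zero_eq_constantCoeff_apply]
  simp [ehrhartSeries]

end Main

end LatticePolytope

theorem mainTheorem9 {d : ℕ} (P : Set (Fin d → ℝ))
    (hreflexive : LatticePolytope.IsReflexive P)
    (hsimplicial : LatticePolytope.IsSimplicial P)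
    (hpseudo : LatticePolytope.IsPseudoSymmetric P) :
    ∃ h : ℤ[X], LatticePolytope.IsHStarPolynomial P h ∧
      LatticePolytope.IsGammaPositive (h.map (Int.castRingHom ℝ)) := by
  open LatticePolytope in
  have hne : P.Nonempty := by
    obtain ⟨S, hS, rfl⟩ := hreflexive.isLatticePolytope
    exact convexHull_nonempty_iff.2 (Set.Nonempty.image _ hS)
  -- In dimension zero every dilate contains exactly one lattice point, so the numerator is `1`;
  -- facet coordinates need a nonempty facet, hence `d > 0`.
  rcases Nat.eq_zero_or_pos d with rfl | hd
  · refine exists_hStarPolynomial hne GammaCone.one ?_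
    have hcount (m : ℕ) : latticeCount P m = 1 := by
      have : {z : Fin 0 → ℤ | latticePoint z ∈ (m : ℝ) • P} = {0} := by
        ext z
        obtain ⟨x, hx⟩ := hne
        exact ⟨fun _ => Subsingleton.elim _ _, fun _ => ⟨x, hx, Subsingleton.elim _ _⟩⟩
      rw [latticeCount, this, Set.ncard_singleton]
    simp [hcount, geom_eq]
  · have : NeZero d := ⟨hd.ne'⟩
    obtain ⟨ι, _, _, b, hcard, hV⟩ := exists_facetCoordinates hreflexive hsimplicial hpseudo
    have : Nonempty ι := by rw [← Fintype.card_pos_iff, hcard]; exact hd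
    obtain ⟨f, hf, hfe⟩ := hV.exists_gammaCone
    rw [hcard] at hf hfe
    refine exists_hStarPolynomial hne hf ?_
    rw [← hfe]
    congr 1
    funext m
    congr 1
    obtain ⟨-, -, hconv⟩ := extremePoints_subset_latticePoint hreflexive.isLatticePolytope
    have himg := (b.equivFun : (Fin d → ℝ) →ₗ[ℝ] (ι → ℝ)).image_convexHull (P.extremePoints ℝ)
    rw [hconv] at himg
    simp only [LinearEquiv.coe_coe] at himg
    rw [← himg, ← image_smul_set, latticeCount,
      ← Set.ncard_image_of_injective _ (b.equivFun.injective.comp latticePoint_injective)]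
    congr 1
    ext z
    constructor
    · rintro ⟨y, hy, rfl⟩
      exact ⟨⟨y, by simp [latticeHom]⟩, ⟨_, hy, rfl⟩⟩
    · rintro ⟨⟨y, hy⟩, x, hx, rfl⟩
      have h1 : latticePoint y = x := by
        have : latticePoint y = b.equivFun.symm (b.equivFun x) := hy
        rwa [LinearEquiv.symm_apply_apply] at this
      exact ⟨y, by rw [Set.mem_ofPred_eq, h1]; exact hx, by simp [h1]⟩
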